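/- Let $[n]=\{1,\dots,n\}$. A valuation with ground set $E\subseteq[n]$ is a function $u:2^{E}\to\mathbb{R}_{\ge 0}$ with $u(\emptyset)=0$ and $u(S)\le u(T)$ whenever $S\subseteq T\subseteq E$. For $p\in\mathbb{R}^n$ the face of $u$ supported by $p$ is the convex hull of the indicator vectors $e_T\in\{0,1\}^n$ of all sets $T\subseteq E$ that maximize $u(T)-\sum_{i\in T}p_i$ over the subsets of $E$. The valuation $u$ is a gross substitutes valuation if, for every $p\in\mathbb{R}^n$, each edge of the face supported by $p$ is parallel to one of the vectors $e_i$ or $e_i-e_j$ ($i\ne j$). Let $\mathcal{GSV}_n$ be the set of all gross substitutes valuations whose ground set is some subset of $[n]$. The merge of valuations $u^1:2^{E^1}\to\mathbb{R}_{\ge0}$ and $u^2:2^{E^2}\to\mathbb{R}_{\ge0}$ is the valuation $u^1\ast u^2$ with ground set $E^1\cup E^2$ given by $$(u^1\ast u^2)(S)=\max\{u^1(T)+u^2(S\setminus T): T\subseteq S,\ T\subseteq E^1,\ S\setminus T\subseteq E^2\}.$$ The endowment of $u:2^{E}\to\mathbb{R}_{\ge0}$ by $T\subseteq E$ is the valuation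 $\partial^Tu$ with ground set $E\setminus T$ given by $\partial^Tu(S)=u(S\cup T)-u(T)$. The weighted rank of a matroid with ground set $E\subseteq[n]$ and family of independent sets $\mathcal{I}$, with weights $w\in\mathbb{R}^n_{\ge0}$, is the valuation $\rho^w$ with ground set $E$ given by $\rho^w(T)=\max\{\sum_{i\in I}w_i: I\in\mathcal{I},\ I\subseteq T\}$. Let $\mathcal{MBV}_{n,n}$ be the smallest set of valuations that contains the weighted ranks of all matroids whose ground set is a subset of $[n]$ and is closed under merging and endowment. For a set partition $\pi$ of $[n]$ and real numbers $0<a<b<2a$, the partition valuation $v^{\pi,a,b}$ with ground set $[n]$ is defined by $v^{\pi,a,b}(\emptyset)=0$ and, for $I\neq\emptyset$, $v^{\pi,a,b}(I)=a$ if $I$ is contained in a part of $\pi$ and $v^{\pi,a,b}(I)=b$ otherwise. Theorem. If $n\le 3$, then $\mathcal{MBV}_{n,n}=\mathcal{GSV}_n$. If $n\ge4$, then $\mathcal{MBV}_{n,n}\subsetneq\mathcal{GSV}_n$; moreover, for every set partition $\pi$ of $[n]$ into at least two parts, each with at least two elements, and all real numbers $0<a<b<2a$, the partition valuation $v^{\pi,a,b}$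 belongs to $\mathcal{GSV}_n$ but not to $\mathcal{MBV}_{n,n}$. -/

import Mathlib

/-- A valuation whose ground set is a subset of `[n]` (modelled by `Fin n`).
A function on the subsets of `ground` is stored through its extension
`T ↦ u (T ∩ ground)` to all subsets of `[n]`; because of `val_inter` this extension is unique,
so that two valuations are equal exactly when they have the same ground set and take the same
values on the subsets of it.  Non-negativity follows from `val_empty` and `val_mono`. -/
@[ext]
structure ItemValuation (n : ℕ) where
  /-- the ground set -/
  ground : Finset (Fin n)
  /-- the values -/
  val : Finset (Fin n) → ℝ
  val_inter : ∀ T, val (T ∩ ground) = val T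
  val_empty : val ∅ = 0
  val_mono : ∀ S T, S ⊆ T → val S ≤ val T

namespace ItemValuation

variable {n : ℕ}

/-- The utility of the bundle `T` under the price vector `p`. -/
def utility (u : ItemValuation n) (p : Fin n → ℝ) (T : Finset (Fin n)) : ℝ :=
  u.val T - ∑ i ∈ T, p i

/-- The cell (demand set) supported by the price vector `p`: all subsets of the ground set
of maximal utility. -/
def demand (u : ItemValuation n) (p : Fin n → ℝ) : Set (Finset (Fin n)) :=
  {T | T ⊆ u.ground ∧ ∀ T', T' ⊆ u.ground → u.utility p T' ≤ u.utility p T}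

/-- The indicator vector `e_T ∈ {0,1}^n` of a set `T`. -/
def indicatorVec (T : Finset (Fin n)) : Fin n → ℝ := fun i => if i ∈ T then 1 else 0

/-- The face supported by `p` of the regular subdivision induced by `u`. -/
def face (u : ItemValuation n) (p : Fin n → ℝ) : Set (Fin n → ℝ) :=
  convexHull ℝ (indicatorVec '' u.demand p)

/-- The segment from `x` to `y` is an edge (a one-dimensional face) of the polytope `P`. -/
def IsEdge (P : Set (Fin n → ℝ)) (x y : Fin n → ℝ) : Prop :=
  x ≠ y ∧ IsExposed ℝ P (segment ℝ x y)

/-- All edges of the polytope `P` are parallel to one of the vectors `e_i` or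
`e_i - e_j`, `i ≠ j`. -/
def IsMNatural (P : Set (Fin n → ℝ)) : Prop :=
  ∀ x y, IsEdge P x y →
    (∃ (i : Fin n) (c : ℝ), y - x = c • (Pi.single i 1 : Fin n → ℝ)) ∨
    (∃ (i j : Fin n) (c : ℝ), i ≠ j ∧
      y - x = c • ((Pi.single i 1 : Fin n → ℝ) - Pi.single j 1))

/-- Gross substitutes: all faces of the regular subdivision induced by `u` are
M-natural polytopes. -/
def IsGrossSubstitutes (u : ItemValuation n) : Prop :=
  ∀ p : Fin n → ℝ, IsMNatural (u.face p)

/-- The merge of two valuations; its ground set is the union of the two ground sets. -/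
def merge (u v : ItemValuation n) : ItemValuation n where
  ground := u.ground ∪ v.ground
  val S := S.powerset.sup' ⟨∅, Finset.empty_mem_powerset S⟩
    (fun T => u.val T + v.val (S \ T))
  val_inter S := by
    apply le_antisymm
    · refine Finset.sup'_le _ _ fun T hT => ?_
      rw [Finset.mem_powerset] at hT
      refine le_trans (add_le_add (le_refl _) (v.val_mono _ (S \ T) ?_))
        (Finset.le_sup' (fun T => u.val T + v.val (S \ T))
          (Finset.mem_powerset.2 (hT.trans Finset.inter_subset_left)))
      exact Finset.sdiff_subset_sdiff Finset.inter_subset_left (le_refl _)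
    · refine Finset.sup'_le _ _ fun T hT => ?_
      rw [Finset.mem_powerset] at hT
      have h : u.val T + v.val (S \ T) ≤ u.val (T ∩ (u.ground ∪ v.ground)) +
          v.val ((S ∩ (u.ground ∪ v.ground)) \ (T ∩ (u.ground ∪ v.ground))) := by
        rw [← u.val_inter T, ← v.val_inter (S \ T)]
        refine add_le_add (u.val_mono _ _ ?_) (v.val_mono _ _ ?_)
        · intro x; simp only [Finset.mem_inter, Finset.mem_union]; tauto
        · intro x; simp only [Finset.mem_inter, Finset.mem_union, Finset.mem_sdiff]; tauto
      exact h.trans (Finset.le_sup' (fun T => u.val T + v.val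
        ((S ∩ (u.ground ∪ v.ground)) \ T))
        (Finset.mem_powerset.2 (Finset.inter_subset_inter hT (le_refl _))))
  val_empty := by simp [u.val_empty, v.val_empty]
  val_mono S S' h := by
    refine Finset.sup'_le _ _ fun T hT => ?_
    rw [Finset.mem_powerset] at hT
    exact le_trans (add_le_add (le_refl _)
      (v.val_mono _ (S' \ T) (Finset.sdiff_subset_sdiff h (le_refl _))))
      (Finset.le_sup' (fun T => u.val T + v.val (S' \ T))
        (Finset.mem_powerset.2 (hT.trans h)))

/-- The endowment of `u` by a set `T`; its ground set is the ground set of `u` without `T`. -/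
def endow (u : ItemValuation n) (T : Finset (Fin n)) : ItemValuation n where
  ground := u.ground \ T
  val S := u.val (S ∪ T) - u.val T
  val_inter S := by
    have h : (S ∩ (u.ground \ T) ∪ T) ∩ u.ground = (S ∪ T) ∩ u.ground := by
      ext x; simp only [Finset.mem_inter, Finset.mem_union, Finset.mem_sdiff]; tauto
    rw [← u.val_inter (S ∩ (u.ground \ T) ∪ T), h, u.val_inter]
  val_empty := by simp
  val_mono S S' h :=
    sub_le_sub_right (u.val_mono _ _ (Finset.union_subset_union h (le_refl _))) _

open Classical in
/-- The independent sets of the matroid `M` that are contained in `T`. -/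
noncomputable def indepIn (M : Matroid (Fin n)) (T : Finset (Fin n)) :
    Finset (Finset (Fin n)) :=
  T.powerset.filter (fun I => M.Indep (I : Set (Fin n)))

theorem mem_indepIn {M : Matroid (Fin n)} {T I : Finset (Fin n)} :
    I ∈ indepIn M T ↔ I ⊆ T ∧ M.Indep (I : Set (Fin n)) := by
  simp [indepIn]

theorem indepIn_nonempty (M : Matroid (Fin n)) (T : Finset (Fin n)) : (indepIn M T).Nonempty :=
  ⟨∅, mem_indepIn.2 ⟨Finset.empty_subset T, by simp⟩⟩

open Classical in
/-- The weighted rank `T ↦ max {∑_{i ∈ I} w_i : I independent, I ⊆ T}` of a matroid whose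
ground set `M.E` is a subset of `[n]`; it is a valuation with the same ground set. -/
noncomputable def weightedRank (M : Matroid (Fin n)) (w : Fin n → NNReal) : ItemValuation n where
  ground := Finset.univ.filter (fun i => i ∈ M.E)
  val T := (indepIn M T).sup' (indepIn_nonempty M T) (fun I => ∑ i ∈ I, (w i : ℝ))
  val_inter T := by
    congr 1
    ext I
    simp only [mem_indepIn]
    refine ⟨fun h => ⟨h.1.trans Finset.inter_subset_left, h.2⟩, fun h => ⟨?_, h.2⟩⟩
    intro i hi
    have := h.2.subset_ground (Finset.mem_coe.2 hi)
    simp [h.1 hi, this]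
  val_empty := by
    apply le_antisymm
    · refine Finset.sup'_le _ _ fun I hI => ?_
      rw [Finset.subset_empty.1 (mem_indepIn.1 hI).1]
      simp
    · refine le_trans (le_of_eq ?_) (Finset.le_sup' _ (mem_indepIn.2 ⟨le_refl ∅, by simp⟩))
      simp
  val_mono S T h := Finset.sup'_mono _
    (fun _ hI => mem_indepIn.2 ⟨(mem_indepIn.1 hI).1.trans h, (mem_indepIn.1 hI).2⟩) _

/-- Membership in the closure, under merging and endowment, of the weighted ranks of all
matroids whose ground set is a subset of `[n]`. -/
inductive IsMatroidBased : ItemValuation n → Prop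
  | weightedRank (M : Matroid (Fin n)) (w : Fin n → NNReal) : IsMatroidBased (weightedRank M w)
  | merge (u v : ItemValuation n) : IsMatroidBased u → IsMatroidBased v → IsMatroidBased (merge u v)
  | endow (u : ItemValuation n) (T : Finset (Fin n)) :
      T ⊆ u.ground → IsMatroidBased u → IsMatroidBased (endow u T)

open Classical in
/-- The partition valuation on `[n]` of the set partition `π` and numbers `0 < a < b`: it is
`0` at `∅`, `a` at the non-empty sets contained in a part of `π`, and `b` at all other sets. -/
noncomputable def partitionValuation (π : Finpartition (Finset.univ : Finset (Fin n)))
    (a b : ℝ) (ha : 0 < a) (hab : a < b) : ItemValuation n where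
  ground := Finset.univ
  val I := if I = ∅ then 0 else if ∃ P ∈ π.parts, I ⊆ P then a else b
  val_inter I := by simp
  val_empty := by simp
  val_mono S T h := by
    by_cases hS : S = ∅
    · rw [if_pos hS]; split_ifs <;> linarith
    · have hT : T ≠ ∅ := fun h0 => hS (Finset.subset_empty.1 (h0 ▸ h))
      rw [if_neg hS, if_neg hT]
      by_cases hP : ∃ P ∈ π.parts, T ⊆ P
      · have hP' : ∃ P ∈ π.parts, S ⊆ P := by
          obtain ⟨P, h1, h2⟩ := hP
          exact ⟨P, h1, h.trans h2⟩
        rw [if_pos hP, if_pos hP']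
      · rw [if_neg hP]; split_ifs <;> linarith

end ItemValuation

/-- The set of gross substitutes valuations whose ground set is some subset of `[n]`. -/
def GSV (n : ℕ) : Set (ItemValuation n) := {u | u.IsGrossSubstitutes}

/-- The closure, under merging and endowment, of the weighted ranks of the matroids whose
ground set is a subset of `[n]`. -/
def MBV (n : ℕ) : Set (ItemValuation n) := {u | u.IsMatroidBased}

/-! Everything runs through the exchange property of M♮-concave functions.

Matroid based valuations have it. For weighted ranks it is the symmetric exchange of independent
sets, and endowing merely translates the sets. A merge is a direct sum on two disjoint copies of the
items, followed by identifying the two copies of each item, one pair at a time; the hard step is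
that identifying two items preserves the exchange property. The property in turn implies gross
substitutes: an exchange between the endpoints of an edge of a face preserves the sum of the
indicator vectors and does not lower the total utility, so it stays on that edge and must produce
its endpoints again. Hence the endpoints differ by a single exchange.

For at most three items, two consequences of gross substitutes suffice for the reverse inclusion:
submodularity, and the fact that among the three sums `u {y, z} + u {x}`, `u {x, z} + u {y}`, `u {x,
y} + u {z}` the maximum is attained at least twice. They allow `u` to be written explicitly as a
merge of three unit demand valuations.

A partition valuation is exchangeable, hence gross substitutes, but cannot be built. A weighted rank
with all singletons worth `a` takes multiples of `a` as values, while `a < b < 2a`. In a merge, the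
two factors cannot both give value `a` to distinct single items, since `2a > b`; so one factor
carries every singleton, the partner of each item inside its part forces the other factor to vanish,
and the first factor is already the partition valuation. An endowment with full ground set is
trivial. -/

/-! ### The exchange property -/

/-- The exchange property of M♮-concave set functions. -/
def IsExchangeable {α : Type*} [DecidableEq α] (f : Finset α → ℝ) : Prop :=
  ∀ S T : Finset α, ∀ i ∈ S, i ∉ T →
    f S + f T ≤ f (S.erase i) + f (insert i T) ∨
    ∃ j ∈ T, j ∉ S ∧ f S + f T ≤ f (insert j (S.erase i)) + f (insert i (T.erase j))

namespace IsExchangeable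

variable {α : Type*} [DecidableEq α] {f : Finset α → ℝ}

theorem union_sub (hf : IsExchangeable f) (R : Finset α) :
    IsExchangeable fun S => f (S ∪ R) - f R := by
  intro S T i hiS hiT
  by_cases hiR : i ∈ R
  · left
    have h1 : S.erase i ∪ R = S ∪ R := by grind
    have h2 : insert i T ∪ R = T ∪ R := by grind
    simp only [h1, h2, le_refl]
  · rcases hf (S ∪ R) (T ∪ R) i (by grind) (by grind) with h | ⟨j, hjT, hjS, h⟩
    · left
      have h1 : S.erase i ∪ R = (S ∪ R).erase i := by grind
      have h2 : insert i T ∪ R = insert i (T ∪ R) := by grind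
      simp only [h1, h2]
      linarith
    · right
      refine ⟨j, by grind, by grind, ?_⟩
      have h1 : insert j (S.erase i) ∪ R = insert j ((S ∪ R).erase i) := by grind
      have h2 : insert i (T.erase j) ∪ R = insert i ((T ∪ R).erase j) := by grind
      simp only [h1, h2]
      linarith

theorem sub_sum (hf : IsExchangeable f) (p : α → ℝ) :
    IsExchangeable fun S => f S - ∑ i ∈ S, p i := by
  intro S T i hiS hiT
  have hS := Finset.add_sum_erase S p hiS
  rcases hf S T i hiS hiT with h | ⟨j, hjT, hjS, h⟩
  · left
    simp only [Finset.sum_insert hiT]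
    linarith
  · right
    refine ⟨j, hjT, hjS, ?_⟩
    have hT := Finset.add_sum_erase T p hjT
    have h1 : j ∉ S.erase i := fun h => hjS (Finset.mem_of_mem_erase h)
    have h2 : i ∉ T.erase j := fun h => hiT (Finset.mem_of_mem_erase h)
    simp only [Finset.sum_insert h1, Finset.sum_insert h2]
    linarith

/-- Exchange against the empty set has nothing to return, so it gives `f S ≤ f (S.erase i) + f {i}`.
-/
theorem eq_zero_of_singleton (hf : IsExchangeable f) (h0 : f ∅ = 0)
    (hmono : ∀ S T, S ⊆ T → f S ≤ f T) (h1 : ∀ i, f {i} = 0) (S : Finset α) : f S = 0 := by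
  induction S using Finset.induction_on with
  | empty => exact h0
  | insert i S hi ih =>
    apply le_antisymm
    · rcases hf (insert i S) ∅ i (by simp) (by simp) with h | ⟨j, hj, -⟩
      · rw [Finset.erase_insert hi, ih, h0, LawfulSingleton.insert_empty_eq, h1] at h
        linarith
      · simp at hj
    · rw [← h0]
      exact hmono _ _ (Finset.empty_subset _)

theorem disjSum {β : Type*} [DecidableEq β] {g : Finset β → ℝ}
    (hf : IsExchangeable f) (hg : IsExchangeable g) :
    IsExchangeable fun S : Finset (α ⊕ β) => f S.toLeft + g S.toRight := by
  intro S T i hiS hiT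
  rcases i with i | i
  · have e1 : (S.erase (.inl i)).toLeft = S.toLeft.erase i := by ext; simp
    have e2 : (S.erase (.inl i)).toRight = S.toRight := by ext; simp
    rcases hf S.toLeft T.toLeft i (by simpa) (by simpa) with h | ⟨j, hjT, hjS, h⟩
    · left
      simp only [e1, e2, Finset.toLeft_insert_inl, Finset.toRight_insert_inl]
      linarith
    · refine Or.inr ⟨.inl j, by simpa using hjT, by simpa using hjS, ?_⟩
      have e3 : (T.erase (.inl j)).toLeft = T.toLeft.erase j := by ext; simp
      have e4 : (T.erase (.inl j)).toRight = T.toRight := by ext; simp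
      simp only [e1, e2, e3, e4, Finset.toLeft_insert_inl, Finset.toRight_insert_inl]
      linarith
  · have e1 : (S.erase (.inr i)).toLeft = S.toLeft := by ext; simp
    have e2 : (S.erase (.inr i)).toRight = S.toRight.erase i := by ext; simp
    rcases hg S.toRight T.toRight i (by simpa) (by simpa) with h | ⟨j, hjT, hjS, h⟩
    · left
      simp only [e1, e2, Finset.toLeft_insert_inr, Finset.toRight_insert_inr]
      linarith
    · refine Or.inr ⟨.inr j, by simpa using hjT, by simpa using hjS, ?_⟩
      have e3 : (T.erase (.inr j)).toLeft = T.toLeft := by ext; simp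
      have e4 : (T.erase (.inr j)).toRight = T.toRight.erase j := by ext; simp
      simp only [e1, e2, e3, e4, Finset.toLeft_insert_inr, Finset.toRight_insert_inr]
      linarith

/-- The exchange after adding the same item to both sets. -/
theorem insert_insert (hf : IsExchangeable f) {x : α} {S T : Finset α}
    (hxS : x ∉ S) {i : α} (hiS : i ∈ S) (hiT : i ∉ T) :
    f (insert x S) + f (insert x T) ≤ f (insert x (S.erase i)) + f (insert x (insert i T)) ∨
    ∃ j ∈ T, j ∉ S ∧ f (insert x S) + f (insert x T) ≤
      f (insert x (insert j (S.erase i))) + f (insert x (insert i (T.erase j))) := by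
  rcases hf (insert x S) (insert x T) i (by grind) (by grind) with h | ⟨j, hjT, hjS, h⟩
  · left
    convert h using 3 <;> grind
  · refine Or.inr ⟨j, by grind, by grind, ?_⟩
    convert h using 3 <;> grind

/-- The exchange after adding the item `x` to one set and `y` to the other, where both choices
are strictly better than the opposite ones. -/
theorem insert_insert_of_lt (hf : IsExchangeable f) {x y : α} (hxy : x ≠ y) {S T : Finset α}
    (hxS : x ∉ S) (hxT : x ∉ T) (hyS : y ∉ S) (hyT : y ∉ T)
    (hS : f (insert y S) < f (insert x S)) (hT : f (insert x T) < f (insert y T))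
    {i : α} (hiS : i ∈ S) (hiT : i ∉ T) :
    (∃ z ∈ ({x, y} : Set α), ∃ z' ∈ ({x, y} : Set α), f (insert x S) + f (insert y T) ≤
      f (insert z (S.erase i)) + f (insert z' (insert i T))) ∨
    ∃ j ∈ T, j ∉ S ∧ ∃ z ∈ ({x, y} : Set α), ∃ z' ∈ ({x, y} : Set α),
      f (insert x S) + f (insert y T) ≤
      f (insert z (insert j (S.erase i))) + f (insert z' (insert i (T.erase j))) := by
  rcases hf (insert x S) (insert y T) i (by grind) (by grind) with h | ⟨j, hjT, hjS, h⟩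
  · refine Or.inl ⟨x, by simp, y, by simp, ?_⟩
    convert h using 3 <;> grind
  -- If `y` itself is returned for `i`, the first set holds both `x` and `y` and the second neither.
  -- A second exchange sends `x` across. Should it return `i`, the net effect would be to swap `x`
  -- and `y`, which the strict inequalities exclude.
  · by_cases hjy : j = y
    · subst hjy
      have e1 : insert j ((insert x S).erase i) = insert x (insert j (S.erase i)) := by grind
      have e2 : (insert j T).erase j = T := by grind
      rw [e1, e2] at h
      rcases hf (insert x (insert j (S.erase i))) (insert i T) x (by grind) (by grind) with
        h' | ⟨k, hkT, hkS, h'⟩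
      · rw [Finset.erase_insert (by grind)] at h'
        exact Or.inl ⟨j, by simp, x, by simp, h.trans h'⟩
      · have e3 : (insert x (insert j (S.erase i))).erase x = insert j (S.erase i) := by grind
        rw [e3] at h'
        by_cases hki : k = i
        · subst hki
          have e4 : insert k (insert j (S.erase k)) = insert j S := by grind
          have e5 : (insert k T).erase k = T := by grind
          rw [e4, e5] at h'
          linarith
        · refine Or.inr ⟨k, by grind, by grind, j, by simp, x, by simp, h.trans ?_⟩
          have e4 : insert k (insert j (S.erase i)) = insert j (insert k (S.erase i)) := by grind
          have e5 : (insert i T).erase k = insert i (T.erase k) := by grind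
          rwa [e4, e5] at h'
    · refine Or.inr ⟨j, by grind, by grind, x, by simp, y, by simp, ?_⟩
      convert h using 3 <;> grind

end IsExchangeable

/-! ### Identifying two items -/

/-- The set function obtained from `f` by identifying the item `y` with the item `x`: a set
containing `x` may use either of the two.  The item `y` itself becomes worthless. -/
noncomputable def identifyItems {α : Type*} [DecidableEq α] (x y : α) (f : Finset α → ℝ)
    (S : Finset α) : ℝ :=
  if x ∈ S then max (f (insert x ((S.erase x).erase y))) (f (insert y ((S.erase x).erase y)))
  else f (S.erase y)

section identifyItems

variable {α : Type*} [DecidableEq α] {f : Finset α → ℝ} {x y : α} {R : Finset α}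

theorem identifyItems_of_notMem (hx : x ∉ R) (hy : y ∉ R) : identifyItems x y f R = f R := by
  simp [identifyItems, hx, Finset.erase_eq_of_notMem hy]

theorem identifyItems_insert (hx : x ∉ R) (hy : y ∉ R) :
    identifyItems x y f (insert x R) = max (f (insert x R)) (f (insert y R)) := by
  simp [identifyItems, hx, Finset.erase_eq_of_notMem hy]

theorem identifyItems_erase (hxy : x ≠ y) :
    identifyItems x y f (R.erase y) = identifyItems x y f R := by
  have e : ((R.erase y).erase x).erase y = (R.erase x).erase y := by grind
  simp only [identifyItems, e, Finset.mem_erase, ne_eq, hxy, not_false_eq_true, true_and,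
    Finset.erase_idem]

theorem identifyItems_insert_self (hxy : x ≠ y) :
    identifyItems x y f (insert y R) = identifyItems x y f R := by
  rw [← identifyItems_erase hxy, Finset.erase_insert_eq_erase, identifyItems_erase hxy]

theorem le_identifyItems_insert (hx : x ∉ R) (hy : y ∉ R) {z : α} (hz : z = x ∨ z = y) :
    f (insert z R) ≤ identifyItems x y f (insert x R) := by
  rw [identifyItems_insert hx hy]
  rcases hz with rfl | rfl
  · exact le_max_left _ _
  · exact le_max_right _ _

end identifyItems

namespace IsExchangeable

variable {α : Type*} [DecidableEq α] {f : Finset α → ℝ}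

/-- If one of `x`, `y` attains both maxima, it can be carried along in `insert_insert`. Otherwise
the preferences are strict and opposite, as `insert_insert_of_lt` requires. -/
theorem max_insert (hf : IsExchangeable f) {x y : α} (hxy : x ≠ y) {S T : Finset α}
    (hxS : x ∉ S) (hxT : x ∉ T) (hyS : y ∉ S) (hyT : y ∉ T)
    {i : α} (hiS : i ∈ S) (hiT : i ∉ T) :
    max (f (insert x S)) (f (insert y S)) + max (f (insert x T)) (f (insert y T)) ≤
      max (f (insert x (S.erase i))) (f (insert y (S.erase i))) +
      max (f (insert x (insert i T))) (f (insert y (insert i T))) ∨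
    ∃ j ∈ T, j ∉ S ∧
    max (f (insert x S)) (f (insert y S)) + max (f (insert x T)) (f (insert y T)) ≤
      max (f (insert x (insert j (S.erase i)))) (f (insert y (insert j (S.erase i)))) +
      max (f (insert x (insert i (T.erase j)))) (f (insert y (insert i (T.erase j)))) := by
  have hle : ∀ z ∈ ({x, y} : Set α), ∀ R, f (insert z R) ≤ max (f (insert x R)) (f (insert y R)) := by
    rintro z (rfl | rfl) R
    · exact le_max_left _ _
    · exact le_max_right _ _
  by_contra hcon
  have same : ∀ z ∈ ({x, y} : Set α), max (f (insert x S)) (f (insert y S)) = f (insert z S) →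
      max (f (insert x T)) (f (insert y T)) = f (insert z T) → False := fun z hz h1 h2 => by
    apply hcon
    rw [h1, h2]
    rcases hf.insert_insert (x := z) (S := S) (T := T) (by grind) hiS hiT with
      h | ⟨j, hjT, hjS, h⟩
    · exact Or.inl (h.trans (add_le_add (hle z hz _) (hle z hz _)))
    · exact Or.inr ⟨j, hjT, hjS, h.trans (add_le_add (hle z hz _) (hle z hz _))⟩
  have mixed : ∀ z ∈ ({x, y} : Set α), ∀ z' ∈ ({x, y} : Set α), z ≠ z' →
      max (f (insert x S)) (f (insert y S)) = f (insert z S) →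
      max (f (insert x T)) (f (insert y T)) = f (insert z' T) →
      f (insert z' S) < f (insert z S) → f (insert z T) < f (insert z' T) → False :=
    fun z hz z' hz' hne h1 h2 h3 h4 => by
    apply hcon
    rw [h1, h2]
    rcases hf.insert_insert_of_lt hne (S := S) (T := T) (by grind) (by grind) (by grind)
      (by grind) h3 h4 hiS hiT with ⟨w, hw, w', hw', h⟩ | ⟨j, hjT, hjS, w, hw, w', hw', h⟩
    · have hw2 : w ∈ ({x, y} : Set α) := by grind
      have hw2' : w' ∈ ({x, y} : Set α) := by grind
      exact Or.inl (h.trans (add_le_add (hle w hw2 _) (hle w' hw2' _)))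
    · have hw2 : w ∈ ({x, y} : Set α) := by grind
      have hw2' : w' ∈ ({x, y} : Set α) := by grind
      exact Or.inr ⟨j, hjT, hjS, h.trans (add_le_add (hle w hw2 _) (hle w' hw2' _))⟩
  have hx : x ∈ ({x, y} : Set α) := by simp
  have hy : y ∈ ({x, y} : Set α) := by simp
  rcases lt_trichotomy (f (insert x S)) (f (insert y S)) with h1 | h1 | h1 <;>
  rcases lt_trichotomy (f (insert x T)) (f (insert y T)) with h2 | h2 | h2
  · exact same y hy (max_eq_right h1.le) (max_eq_right h2.le)
  · exact same y hy (max_eq_right h1.le) (max_eq_right h2.le)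
  · exact mixed y hy x hx hxy.symm (max_eq_right h1.le) (max_eq_left h2.le) h1 h2
  · exact same y hy (max_eq_right h1.le) (max_eq_right h2.le)
  · exact same y hy (max_eq_right h1.le) (max_eq_right h2.le)
  · exact same x hx (max_eq_left h1.ge) (max_eq_left h2.le)
  · exact mixed x hx y hy hxy (max_eq_left h1.le) (max_eq_right h2.le) h1 h2
  · exact same x hx (max_eq_left h1.le) (max_eq_left h2.ge)
  · exact same x hx (max_eq_left h1.le) (max_eq_left h2.le)

theorem identifyItems_of_mem_of_mem (hf : IsExchangeable f) {x y : α} (hxy : x ≠ y)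
    {S T : Finset α} (hxS : x ∉ S) (hyS : y ∉ S) (hxT : x ∉ T) (hyT : y ∉ T) {i : α}
    (hiS : i ∈ S) (hiT : i ∉ T) (g : Finset α → ℝ) (hg : g = identifyItems x y f) :
    g (insert x S) + g (insert x T) ≤
      g ((insert x S).erase i) + g (insert i (insert x T)) ∨
    ∃ j ∈ T, j ∉ S ∧ g (insert x S) + g (insert x T) ≤
      g (insert j ((insert x S).erase i)) + g (insert i ((insert x T).erase j)) := by
  subst hg
  have hix : i ≠ x := by grind
  have e1 : (insert x S).erase i = insert x (S.erase i) := by grind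
  have e2 : insert i (insert x T) = insert x (insert i T) := by grind
  rw [identifyItems_insert hxS hyS, identifyItems_insert hxT hyT, e1, e2,
    identifyItems_insert (by grind) (by grind), identifyItems_insert (by grind) (by grind)]
  rcases hf.max_insert hxy hxS hxT hyS hyT hiS hiT with h | ⟨j, hjT, hjS, h⟩
  · exact Or.inl h
  · refine Or.inr ⟨j, hjT, hjS, h.trans_eq ?_⟩
    have e3 : insert j (insert x (S.erase i)) = insert x (insert j (S.erase i)) := by grind
    have e4 : insert i ((insert x T).erase j) = insert x (insert i (T.erase j)) := by grind
    rw [e3, e4, identifyItems_insert (by grind) (by grind),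
      identifyItems_insert (by grind) (by grind)]

/-- The item `z` is meant to attain the value of `g` at `insert x S`. One exchange for `f` suffices:
`z` ends up in exactly one of the two new sets, where passing from `f` to `g` and from `z` to `x`
can only increase the value. -/
theorem identifyItems_of_mem_of_notMem (hf : IsExchangeable f) {x y : α}
    {S T : Finset α} (hxS : x ∉ S) (hyS : y ∉ S) (hxT : x ∉ T) (hyT : y ∉ T) {i : α}
    (hiS : i ∈ insert x S) (hiT : i ∉ T) (g : Finset α → ℝ) (hg : g = identifyItems x y f)
    {z : α} (hz : z = x ∨ z = y) :
    f (insert z S) + g T ≤ g ((insert x S).erase i) + g (insert i T) ∨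
    ∃ j ∈ T, j ∉ insert x S ∧
      f (insert z S) + g T ≤ g (insert j ((insert x S).erase i)) + g (insert i (T.erase j)) := by
  have gout : ∀ {R}, x ∉ R → y ∉ R → g R = f R := fun h1 h2 =>
    hg ▸ identifyItems_of_notMem h1 h2
  have hle : ∀ {R}, x ∉ R → y ∉ R → f (insert z R) ≤ g (insert x R) := fun h1 h2 =>
    hg ▸ le_identifyItems_insert h1 h2 hz
  clear hg
  have hzS : z ∉ S := by grind
  have hzT : z ∉ T := by grind
  rw [gout hxT hyT]
  by_cases hix : i = x
  · subst hix
    rw [Finset.erase_insert hxS, gout hxS hyS]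
    rcases hf (insert z S) T z (by grind) hzT with h | ⟨j, hjT, hjS, h⟩
    · rw [Finset.erase_insert hzS] at h
      have := hle hxT hyT
      left; linarith
    · rw [Finset.erase_insert hzS] at h
      refine Or.inr ⟨j, hjT, by grind, ?_⟩
      have := hle (R := T.erase j) (by grind) (by grind)
      rw [gout (R := insert j S) (by grind) (by grind)]
      linarith
  · have e1 : (insert x S).erase i = insert x (S.erase i) := by grind
    have e2 : (insert z S).erase i = insert z (S.erase i) := by grind
    rcases hf (insert z S) T i (by grind) hiT with h | ⟨j, hjT, hjS, h⟩
    · have := hle (R := S.erase i) (by grind) (by grind)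
      rw [e1, gout (R := insert i T) (by grind) (by grind)]
      rw [e2] at h
      left; linarith
    · refine Or.inr ⟨j, hjT, by grind, ?_⟩
      have := hle (R := insert j (S.erase i)) (by grind) (by grind)
      have e3 : insert j (insert x (S.erase i)) = insert x (insert j (S.erase i)) := by grind
      have e4 : insert j (insert z (S.erase i)) = insert z (insert j (S.erase i)) := by grind
      rw [e1, e3, gout (R := insert i (T.erase j)) (by grind) (by grind)]
      rw [e2, e4] at h
      linarith

theorem identifyItems_of_notMem_of_mem (hf : IsExchangeable f) {x y : α}
    {S T : Finset α} (hxS : x ∉ S) (hyS : y ∉ S) (hxT : x ∉ T) (hyT : y ∉ T) {i : α}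
    (hiS : i ∈ S) (hiT : i ∉ T) (g : Finset α → ℝ) (hg : g = identifyItems x y f)
    {z : α} (hz : z = x ∨ z = y) :
    g S + f (insert z T) ≤ g (S.erase i) + g (insert i (insert x T)) ∨
    ∃ j ∈ insert x T, j ∉ S ∧ g S + f (insert z T) ≤
      g (insert j (S.erase i)) + g (insert i ((insert x T).erase j)) := by
  have gout : ∀ {R}, x ∉ R → y ∉ R → g R = f R := fun h1 h2 =>
    hg ▸ identifyItems_of_notMem h1 h2
  have hle : ∀ {R}, x ∉ R → y ∉ R → f (insert z R) ≤ g (insert x R) := fun h1 h2 =>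
    hg ▸ le_identifyItems_insert h1 h2 hz
  clear hg
  have hzS : z ∉ S := by grind
  have hzT : z ∉ T := by grind
  rw [gout hxS hyS]
  rcases hf S (insert z T) i hiS (by grind) with h | ⟨j, hjT, hjS, h⟩
  · have := hle (R := insert i T) (by grind) (by grind)
    rw [Finset.insert_comm, gout (R := S.erase i) (by grind) (by grind)]
    rw [Finset.insert_comm] at h
    left; linarith
  -- Returning `z` for `f` is read as returning `x` for `g`.
  · by_cases hjz : j = z
    · subst hjz
      refine Or.inr ⟨x, by grind, hxS, ?_⟩
      have := hle (R := S.erase i) (by grind) (by grind)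
      rw [Finset.erase_insert hxT, gout (R := insert i T) (by grind) (by grind)]
      rw [Finset.erase_insert hzT] at h
      linarith
    · refine Or.inr ⟨j, by grind, hjS, ?_⟩
      have := hle (R := insert i (T.erase j)) (by grind) (by grind)
      have e1 : insert i ((insert x T).erase j) = insert x (insert i (T.erase j)) := by grind
      have e2 : insert i ((insert z T).erase j) = insert z (insert i (T.erase j)) := by grind
      rw [e1, gout (R := insert j (S.erase i)) (by grind) (by grind)]
      rw [e2] at h
      linarith

theorem identifyItems (hf : IsExchangeable f) {x y : α} (hxy : x ≠ y) :
    IsExchangeable (identifyItems x y f) := by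
  obtain ⟨g, hg⟩ : ∃ g, g = _root_.identifyItems x y f := ⟨_, rfl⟩
  rw [← hg]
  have gout : ∀ {R}, x ∉ R → y ∉ R → g R = f R := fun h1 h2 =>
    hg ▸ identifyItems_of_notMem h1 h2
  have gerase : ∀ R, g (R.erase y) = g R := fun R => hg ▸ identifyItems_erase hxy
  intro S T i hiS hiT
  -- Since `g` ignores `y`, moving `y` costs nothing, and in all other cases both sets may be
  -- assumed to omit it.
  by_cases hiy : i = y
  · subst hiy
    left
    rw [gerase, hg, identifyItems_insert_self hxy]
  suffices h : g (S.erase y) + g (T.erase y) ≤ g ((S.erase y).erase i) + g (insert i (T.erase y)) ∨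
      ∃ j ∈ T.erase y, j ∉ S.erase y ∧ g (S.erase y) + g (T.erase y) ≤
        g (insert j ((S.erase y).erase i)) + g (insert i ((T.erase y).erase j)) by
    rw [gerase, gerase] at h
    rcases h with h | ⟨j, hjT, hjS, h⟩
    · left
      have e1 : (S.erase y).erase i = (S.erase i).erase y := by grind
      have e2 : insert i (T.erase y) = (insert i T).erase y := by grind
      rwa [e1, e2, gerase, gerase] at h
    · refine Or.inr ⟨j, by grind, by grind, ?_⟩
      have e1 : insert j ((S.erase y).erase i) = (insert j (S.erase i)).erase y := by grind
      have e2 : insert i ((T.erase y).erase j) = (insert i (T.erase j)).erase y := by grind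
      rwa [e1, e2, gerase, gerase] at h
  replace hiS : i ∈ S.erase y := by grind
  replace hiT : i ∉ T.erase y := by grind
  have hyS : y ∉ S.erase y := by simp
  have hyT : y ∉ T.erase y := by simp
  generalize S.erase y = S at *
  generalize T.erase y = T at *
  by_cases hxS : x ∈ S <;> by_cases hxT : x ∈ T
  · obtain ⟨S, hxS', rfl⟩ : ∃ S', x ∉ S' ∧ insert x S' = S := ⟨S.erase x, by simp, by grind⟩
    obtain ⟨T, hxT', rfl⟩ : ∃ T', x ∉ T' ∧ insert x T' = T := ⟨T.erase x, by simp, by grind⟩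
    rcases hf.identifyItems_of_mem_of_mem hxy hxS' (by grind) hxT' (by grind) (i := i)
      (by grind) (by grind) g hg with h | ⟨j, hjT, hjS, h⟩
    · exact Or.inl h
    · exact Or.inr ⟨j, by grind, by grind, h⟩
  · obtain ⟨S, hxS', rfl⟩ : ∃ S', x ∉ S' ∧ insert x S' = S := ⟨S.erase x, by simp, by grind⟩
    have key := fun z => hf.identifyItems_of_mem_of_notMem hxS' (y := y) (by grind) hxT hyT hiS hiT
      g hg (z := z)
    have hmax : g (insert x S) = _ := hg ▸ identifyItems_insert hxS' (by grind)
    rw [hmax]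
    rcases max_choice (f (insert x S)) (f (insert y S)) with h | h
    · rw [h]; exact key x (Or.inl rfl)
    · rw [h]; exact key y (Or.inr rfl)
  · obtain ⟨T, hxT', rfl⟩ : ∃ T', x ∉ T' ∧ insert x T' = T := ⟨T.erase x, by simp, by grind⟩
    have key := fun z => hf.identifyItems_of_notMem_of_mem hxS hyS hxT' (y := y) (by grind) hiS
      (by grind) g hg (z := z)
    have hmax : g (insert x T) = _ := hg ▸ identifyItems_insert hxT' (by grind)
    rw [hmax]
    rcases max_choice (f (insert x T)) (f (insert y T)) with h | h
    · rw [h]; exact key x (Or.inl rfl)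
    · rw [h]; exact key y (Or.inr rfl)
  · rw [gout hxS hyS, gout hxT hyT, gout (R := S.erase i) (by grind) (by grind),
      gout (R := insert i T) (by grind) (by grind)]
    rcases hf S T i hiS hiT with h | ⟨j, hjT, hjS, h⟩
    · exact Or.inl h
    · refine Or.inr ⟨j, hjT, hjS, ?_⟩
      rwa [gout (by grind) (by grind), gout (by grind) (by grind)]

end IsExchangeable

/-! ### Merging as a direct sum with identified copies -/

namespace IsExchangeable

variable {α : Type*} [DecidableEq α] {f g : Finset α → ℝ}

/-- Identifying the two copies of the items of `K` in the direct sum of `f` and `g`. -/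
theorem exists_disjSum_identified (hf : IsExchangeable f) (hg : IsExchangeable g) (K : Finset α) :
    ∃ F : Finset (α ⊕ α) → ℝ, IsExchangeable F ∧ ∀ A C,
      (∀ X ⊆ A ∩ K, f (A \ X) + g (C \ K ∪ X) ≤ F (A.disjSum C)) ∧
      ∃ X ⊆ A ∩ K, F (A.disjSum C) = f (A \ X) + g (C \ K ∪ X) := by
  induction K using Finset.induction_on with
  | empty =>
    refine ⟨_, hf.disjSum hg, fun A C => ⟨fun X hX => ?_, ∅, by simp, by simp⟩⟩
    obtain rfl : X = ∅ := by simpa using hX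
    simp
  | insert k K hk ih =>
    obtain ⟨F, hF, hFval⟩ := ih
    refine ⟨_root_.identifyItems (.inl k) (.inr k) F, hF.identifyItems (by simp), fun A C => ?_⟩
    -- The set `X` consists of the identified items of `A` that use their right copy. The two terms
    -- of the maximum below are the choices `k ∉ X` and `k ∈ X`.
    by_cases hkA : k ∈ A
    · have e1 : insert (Sum.inl k) (((A.disjSum C).erase (.inl k)).erase (.inr k)) =
          A.disjSum (C.erase k) := by
        ext (x | x) <;> simp; grind
      have e2 : insert (Sum.inr k) (((A.disjSum C).erase (.inl k)).erase (.inr k)) =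
          (A.erase k).disjSum (insert k C) := by
        ext (x | x) <;> simp
        tauto
      have e3 : _root_.identifyItems (.inl k) (.inr k) F (A.disjSum C) =
          max (F (A.disjSum (C.erase k))) (F ((A.erase k).disjSum (insert k C))) := by
        rw [_root_.identifyItems, if_pos (by simpa), e1, e2]
      rw [e3]
      constructor
      · intro X hX
        by_cases hkX : k ∈ X
        · refine le_trans ?_ (le_max_right _ _)
          refine le_trans (le_of_eq ?_)
            ((hFval (A.erase k) (insert k C)).1 (X.erase k) (by grind))
          congr 2 <;> grind
        · refine le_trans ?_ (le_max_left _ _)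
          refine le_trans (le_of_eq ?_) ((hFval A (C.erase k)).1 X (by grind))
          congr 2
          grind
      · rcases max_choice (F (A.disjSum (C.erase k))) (F ((A.erase k).disjSum (insert k C)))
          with h | h
        · obtain ⟨X, hX, hX'⟩ := (hFval A (C.erase k)).2
          refine ⟨X, by grind, ?_⟩
          rw [h, hX']
          congr 2
          grind
        · obtain ⟨X, hX, hX'⟩ := (hFval (A.erase k) (insert k C)).2
          refine ⟨insert k X, by grind, ?_⟩
          rw [h, hX']
          congr 2 <;> grind
    · have e1 : (A.disjSum C).erase (.inr k) = A.disjSum (C.erase k) := by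
        ext (x | x) <;> simp
      have e2 : A ∩ insert k K = A ∩ K := by grind
      have e3 : C.erase k \ K = C \ insert k K := by grind
      rw [_root_.identifyItems, if_neg (by simpa), e1, e2, ← e3]
      exact hFval A (C.erase k)

/-- The hypotheses make `h` the merge of `f` and `g`. Once all copies are identified, `h` is the
restriction of `F` to sets of left copies, and an exchange between two such sets never involves a
right copy. -/
theorem of_forall_exists [Fintype α] (hf : IsExchangeable f) (hg : IsExchangeable g)
    {h : Finset α → ℝ} (hle : ∀ S, ∀ X ⊆ S, f X + g (S \ X) ≤ h S)
    (hex : ∀ S, ∃ X ⊆ S, h S = f X + g (S \ X)) : IsExchangeable h := by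
  obtain ⟨F, hF, hFval⟩ := hf.exists_disjSum_identified hg Finset.univ
  have hh : ∀ S, h S = F (S.disjSum ∅) := by
    intro S
    apply le_antisymm
    · obtain ⟨X, hX, hX'⟩ := hex S
      rw [hX']
      refine le_trans (le_of_eq ?_) ((hFval S ∅).1 (S \ X) (by simp))
      congr 2 <;> grind
    · obtain ⟨X, hX, hX'⟩ := (hFval S ∅).2
      rw [hX']
      refine le_trans (le_of_eq ?_) (hle S (S \ X) Finset.sdiff_subset)
      congr 2
      grind
  intro S T i hiS hiT
  rcases hF (S.disjSum ∅) (T.disjSum ∅) (.inl i) (by simpa) (by simpa) with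
    h1 | ⟨j | j, hjT, hjS, h1⟩
  · left
    have e1 : (S.erase i).disjSum (∅ : Finset α) = (S.disjSum ∅).erase (.inl i) := by
      ext (x | x) <;> simp
    have e2 : (insert i T).disjSum (∅ : Finset α) = insert (.inl i) (T.disjSum ∅) := by
      ext (x | x) <;> simp
    rwa [hh, hh, hh, hh, e1, e2]
  · refine Or.inr ⟨j, by simpa using hjT, by simpa using hjS, ?_⟩
    have e1 : (insert j (S.erase i)).disjSum (∅ : Finset α) =
        insert (.inl j) ((S.disjSum ∅).erase (.inl i)) := by
      ext (x | x) <;> simp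
    have e2 : (insert i (T.erase j)).disjSum (∅ : Finset α) =
        insert (.inl i) ((T.disjSum ∅).erase (.inl j)) := by
      ext (x | x) <;> simp
    rwa [hh, hh, hh, hh, e1, e2]
  · simp at hjT

end IsExchangeable

/-! ### Weighted ranks of matroids -/

/-- Every `j` in the fundamental circuit of `i` with respect to `J` may leave `insert i J`. If none
of those outside `I` could replace `i` in `I`, the circuit without `i` would lie in the closure of
`I \ {i}`, and so would `i`, contradicting the independence of `I`. -/
theorem Matroid.Indep.exists_symm_exchange {α : Type*} {M : Matroid α} {I J : Set α}
    (hI : M.Indep I) (hJ : M.Indep J) {i : α} (hiI : i ∈ I) (hiJ : i ∉ J)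
    (hi : ¬ M.Indep (insert i J)) :
    ∃ j ∈ J, j ∉ I ∧ M.Indep (insert j (I \ {i})) ∧ M.Indep (insert i J \ {j}) := by
  have hiE : i ∈ M.E := hI.subset_ground hiI
  have hcl : i ∈ M.closure J := by
    by_contra h
    exact hi ((hJ.notMem_closure_iff_of_notMem hiJ hiE).1 h)
  have hC := hJ.fundCircuit_isCircuit hcl hiJ
  have hiC := hC.mem_closure_sdiff_singleton_of_mem (M.mem_fundCircuit i J)
  by_contra! hcon
  have hsub : M.fundCircuit i J \ {i} ⊆ M.closure (I \ {i}) := by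
    rintro j ⟨hjC, hji⟩
    have hjJ : j ∈ J := ((M.fundCircuit_subset_insert i J) hjC).resolve_left hji
    by_cases hjI : j ∈ I
    · exact M.subset_closure _ ((hI.subset Set.sdiff_subset).subset_ground) ⟨hjI, hji⟩
    · by_contra hj
      have h1 := (hI.subset (Set.sdiff_subset (t := {i}))).insert_indep_iff.2
        (Or.inl ⟨hJ.subset_ground hjJ, hj⟩)
      exact hcon j hjJ hjI h1 ((hJ.mem_fundCircuit_iff hcl hiJ).1 hjC)
  have := M.closure_subset_closure_of_subset_closure hsub hiC
  exact hI.notMem_closure_sdiff_of_mem hiI this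

namespace ItemValuation

variable {n : ℕ}

theorem le_merge (u v : ItemValuation n) {X S : Finset (Fin n)} (h : X ⊆ S) :
    u.val X + v.val (S \ X) ≤ (merge u v).val S :=
  Finset.le_sup' (fun T => u.val T + v.val (S \ T)) (Finset.mem_powerset.2 h)

theorem exists_merge_eq (u v : ItemValuation n) (S : Finset (Fin n)) :
    ∃ X ⊆ S, (merge u v).val S = u.val X + v.val (S \ X) := by
  obtain ⟨X, hX, h⟩ := Finset.exists_mem_eq_sup' (s := S.powerset)
    ⟨∅, Finset.empty_mem_powerset S⟩ (fun T => u.val T + v.val (S \ T))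
  exact ⟨X, Finset.mem_powerset.1 hX, h⟩

theorem le_weightedRank (M : Matroid (Fin n)) (w : Fin n → NNReal) {I T : Finset (Fin n)}
    (hIT : I ⊆ T) (hI : M.Indep (I : Set (Fin n))) :
    ∑ i ∈ I, (w i : ℝ) ≤ (weightedRank M w).val T :=
  Finset.le_sup' (fun I => ∑ i ∈ I, (w i : ℝ)) (mem_indepIn.2 ⟨hIT, hI⟩)

theorem exists_weightedRank_eq (M : Matroid (Fin n)) (w : Fin n → NNReal) (T : Finset (Fin n)) :
    ∃ I ⊆ T, M.Indep (I : Set (Fin n)) ∧ (weightedRank M w).val T = ∑ i ∈ I, (w i : ℝ) := by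
  obtain ⟨I, hI, h⟩ := Finset.exists_mem_eq_sup' (indepIn_nonempty M T)
    (fun I => ∑ i ∈ I, (w i : ℝ))
  exact ⟨I, (mem_indepIn.1 hI).1, (mem_indepIn.1 hI).2, h⟩

theorem weightedRank_isExchangeable (M : Matroid (Fin n)) (w : Fin n → NNReal) :
    IsExchangeable (weightedRank M w).val := by
  intro S T i hiS hiT
  obtain ⟨I, hIS, hI, hS⟩ := exists_weightedRank_eq M w S
  obtain ⟨J, hJT, hJ, hT⟩ := exists_weightedRank_eq M w T
  by_cases hiI : i ∈ I
  · have hiJ : i ∉ J := fun h => hiT (hJT h)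
    have hsum := Finset.add_sum_erase I (fun i => (w i : ℝ)) hiI
    by_cases hi : M.Indep ((insert i J : Finset (Fin n)) : Set (Fin n))
    · left
      have h1 := le_weightedRank M w (Finset.erase_subset_erase i hIS)
        (hI.subset (by simp))
      have h2 := le_weightedRank M w (Finset.insert_subset_insert i hJT) hi
      rw [Finset.sum_insert hiJ] at h2
      linarith
    · obtain ⟨j, hjJ, hjI, h1, h2⟩ := hI.exists_symm_exchange hJ hiI hiJ
        (by simpa only [Finset.coe_insert] using hi)
      rw [Finset.mem_coe] at hjJ hjI
      have hji : j ≠ i := fun h => hiJ (h ▸ hjJ)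
      have h1' : M.Indep ((insert j (I.erase i) : Finset (Fin n)) : Set (Fin n)) := by simpa using h1
      have h2' : M.Indep ((insert i (J.erase j) : Finset (Fin n)) : Set (Fin n)) := by
        rw [← Finset.erase_insert_of_ne hji.symm]
        simpa using h2
      have s1 : ∑ k ∈ insert j (I.erase i), (w k : ℝ) = w j + ∑ k ∈ I.erase i, (w k : ℝ) :=
        Finset.sum_insert (by simp [hjI])
      have s2 : ∑ k ∈ insert i (J.erase j), (w k : ℝ) = w i + ∑ k ∈ J.erase j, (w k : ℝ) :=
        Finset.sum_insert (by simp [hiJ])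
      have hsum' := Finset.add_sum_erase J (fun i => (w i : ℝ)) hjJ
      -- If `j` already lies in `S`, the new independent set fits inside `S.erase i`, so nothing has
      -- to be returned.
      by_cases hjS : j ∈ S
      · left
        have h3 := le_weightedRank M w (T := S.erase i) (by grind) h1'
        have h4 := le_weightedRank M w (T := insert i T) (by grind) h2'
        linarith
      · refine Or.inr ⟨j, hJT hjJ, hjS, ?_⟩
        have h3 := le_weightedRank M w (T := insert j (S.erase i)) (by grind) h1'
        have h4 := le_weightedRank M w (T := insert i (T.erase j)) (by grind) h2'
        linarith
  · left
    have h1 := le_weightedRank M w (T := S.erase i) (by grind) hI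
    have h2 := (weightedRank M w).val_mono T (insert i T) (Finset.subset_insert _ _)
    linarith

theorem IsMatroidBased.isExchangeable {u : ItemValuation n} (hu : u.IsMatroidBased) :
    IsExchangeable u.val := by
  induction hu with
  | weightedRank M w => exact weightedRank_isExchangeable M w
  | merge u v _ _ hu hv =>
    exact hu.of_forall_exists hv (fun S X hX => le_merge u v hX) (exists_merge_eq u v)
  | endow u T _ _ hu => exact hu.union_sub T

/-! ### Partition valuations are exchangeable -/

theorem partitionValuation_isExchangeable (π : Finpartition (Finset.univ : Finset (Fin n)))
    (a b : ℝ) (ha : 0 < a) (hab : a < b) (hb : b < 2 * a) :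
    IsExchangeable (partitionValuation π a b ha hab).val := by
  obtain ⟨v, hv⟩ : ∃ v, v = (partitionValuation π a b ha hab).val := ⟨_, rfl⟩
  rw [← hv]
  have v0 : v ∅ = 0 := by simp [hv, partitionValuation]
  have vb : ∀ {I : Finset (Fin n)} {i j}, i ∈ I → j ∈ I → π.part i ≠ π.part j → v I = b := by
    intro I i j hi hj hij
    have h1 : I ≠ ∅ := Finset.ne_empty_of_mem hi
    have h2 : ¬ ∃ P ∈ π.parts, I ⊆ P := by
      rintro ⟨P, hP, hIP⟩
      exact hij ((π.part_eq_of_mem hP (hIP hi)).trans (π.part_eq_of_mem hP (hIP hj)).symm)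
    simp [hv, partitionValuation, h1, h2]
  have va : ∀ {I : Finset (Fin n)} {i}, i ∈ I → (∀ j ∈ I, π.part j = π.part i) → v I = a := by
    intro I i hi h
    have h1 : I ≠ ∅ := Finset.ne_empty_of_mem hi
    have h2 : ∃ P ∈ π.parts, I ⊆ P :=
      ⟨π.part i, π.part_mem.2 (Finset.mem_univ i),
        fun j hj => h j hj ▸ π.mem_part (Finset.mem_univ j)⟩
    simp [hv, partitionValuation, h1, h2]
  have vcases : ∀ {I : Finset (Fin n)} {i}, i ∈ I → (v I = a ∧ ∀ j ∈ I, π.part j = π.part i) ∨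
      (v I = b ∧ ∃ j ∈ I, π.part j ≠ π.part i) := by
    intro I i hi
    by_cases h : ∀ j ∈ I, π.part j = π.part i
    · exact Or.inl ⟨va hi h, h⟩
    · push Not at h
      obtain ⟨j, hj, hji⟩ := h
      exact Or.inr ⟨vb hj hi hji, j, hj, hji⟩
  have vge : ∀ {I : Finset (Fin n)} {i}, i ∈ I → a ≤ v I := by
    intro I i hi
    rcases vcases hi with h | h <;> linarith [h.1]
  have vmono : ∀ {I J}, I ⊆ J → v I ≤ v J := fun h => hv ▸ val_mono _ _ _ h
  clear hv
  intro S T i hiS hiT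
  -- Only an `i` whose removal lowers the value matters. Then `S = {i}`, or `S.erase i` lies in a
  -- single part that does not contain `i`.
  by_cases hSi : v S ≤ v (S.erase i)
  · exact Or.inl (add_le_add hSi (vmono (Finset.subset_insert i T)))
  push Not at hSi
  rcases T.eq_empty_or_nonempty with rfl | ⟨t, ht⟩
  · left
    have h1 : v (insert i ∅) = a := va (Finset.mem_insert_self i _) (by simp)
    rw [v0, h1]
    rcases (S.erase i).eq_empty_or_nonempty with h | ⟨s, hs⟩
    · have : v S = a := va hiS (by grind)
      rw [h]
      linarith
    · have := vge hs
      rcases vcases hiS with h | h <;> linarith [h.1]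
  rcases (S.erase i).eq_empty_or_nonempty with hS0 | ⟨s, hs⟩
  · have hS : S = {i} := by grind
    have hvS : v S = a := va hiS (by simp [hS])
    rw [hS0, hvS]
    have hkey : ∀ j, a ≤ v (insert j ∅) := fun j => vge (Finset.mem_insert_self j _)
    have hjS : ∀ j ∈ T, j ∉ S := fun j hj hjS => by grind
    rcases vcases ht with ⟨hvT, -⟩ | ⟨hvT, -⟩
    · refine Or.inr ⟨t, ht, hjS t ht, ?_⟩
      have := vge (Finset.mem_insert_self i (T.erase t))
      linarith [hkey t]
    · rw [hvT]
      -- Any item of `T` other than `j₀` may be returned: `i` and `j₀` stay together and keep the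
      -- value `b`.
      obtain ⟨j₀, hj₀, hj₀i⟩ : ∃ j₀ ∈ T, π.part j₀ ≠ π.part i := by
        by_contra! h
        have := va ht fun j hj => (h j hj).trans (h t ht).symm
        linarith
      obtain ⟨j, hj, hjj₀⟩ : ∃ j ∈ T, j ≠ j₀ := by
        by_contra! h
        have := va hj₀ fun j hj => by rw [h j hj]
        linarith
      refine Or.inr ⟨j, hj, hjS j hj, ?_⟩
      have : v (insert i (T.erase j)) = b :=
        vb (i := j₀) (by grind) (Finset.mem_insert_self i _) hj₀i
      linarith [hkey j]
  · have hvSi : v (S.erase i) = a ∧ ∀ j ∈ S.erase i, π.part j = π.part s := by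
      rcases vcases hs with h | h
      · exact h
      · exfalso
        rcases vcases hiS with h' | h' <;> linarith [h.1, h'.1]
    have hvS : v S = b := by
      rcases vcases hiS with h' | h' <;> linarith [hvSi.1, h'.1]
    have his : π.part i ≠ π.part s := by
      intro h
      have : v S = a := va hiS fun j hj => by
        by_cases hji : j = i
        · rw [hji]
        · rw [hvSi.2 j (Finset.mem_erase.2 ⟨hji, hj⟩), h]
      linarith
    have hout : ∀ j ∈ T, π.part j ≠ π.part s → j ∉ S := fun j hj hjs hjS =>
      hjs (hvSi.2 j (Finset.mem_erase.2 ⟨fun h => hiT (h ▸ hj), hjS⟩))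
    have hvj : ∀ j, π.part j ≠ π.part s → v (insert j (S.erase i)) = b := fun j hj =>
      vb (Finset.mem_insert_self j _) (Finset.mem_insert_of_mem hs) hj
    rw [hvS]
    rcases vcases ht with ⟨hvT, hT⟩ | ⟨hvT, t', ht', htt'⟩
    · by_cases hti : π.part t = π.part i
      · have hts : π.part t ≠ π.part s := hti ▸ his
        refine Or.inr ⟨t, ht, hout t ht hts, ?_⟩
        have := vge (Finset.mem_insert_self i (T.erase t))
        linarith [hvj t hts]
      · left
        have : v (insert i T) = b := vb (Finset.mem_insert_of_mem ht) (Finset.mem_insert_self i T) hti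
        linarith [hvSi.1]
    · rw [hvT]
      -- If every `j` outside the part of `s` failed, the remaining items of `T` would lie in the
      -- part of `i`. Applying this to two such items puts all of `T` in that part, contradicting `v
      -- T = b`.
      obtain ⟨j, hj, hjs, h⟩ : ∃ j ∈ T, π.part j ≠ π.part s ∧ v (insert i (T.erase j)) = b := by
        by_contra! hcon
        have h1 : ∀ j ∈ T, π.part j ≠ π.part s → ∀ k ∈ T, k ≠ j → π.part k = π.part i := by
          intro j hj hjs k hk hkj
          by_contra hki
          exact hcon j hj hjs (vb (i := k) (by grind) (Finset.mem_insert_self i _) hki)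
        obtain ⟨j, hj, hjs⟩ : ∃ j ∈ T, π.part j ≠ π.part s := by
          by_contra! h
          exact htt' ((h t' ht').trans (h t ht).symm)
        have h2 := h1 j hj hjs
        obtain ⟨k, hk, hkj⟩ : ∃ k ∈ T, k ≠ j := by
          by_contra! h
          exact htt' (by rw [h t' ht', h t ht])
        have h3 := h1 k hk (h2 k hk hkj ▸ his)
        have h4 : ∀ l ∈ T, π.part l = π.part i := fun l hl => by
          by_cases hlj : l = j
          · exact hlj ▸ h3 j hj hkj.symm
          · exact h2 l hl hlj
        exact htt' ((h4 t' ht').trans (h4 t ht).symm)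
      exact Or.inr ⟨j, hj, hout j hj hjs, by linarith [hvj j hjs]⟩

/-! ### Exchangeable valuations are gross substitutes -/

theorem indicatorVec_injective : Function.Injective (indicatorVec (n := n)) := by
  intro S T h
  ext i
  have := congrFun h i
  by_cases h1 : i ∈ S <;> by_cases h2 : i ∈ T <;> simp_all [indicatorVec]

theorem indicatorVec_eq_of_mem_segment {R S T : Finset (Fin n)}
    (h : indicatorVec R ∈ segment ℝ (indicatorVec S) (indicatorVec T)) : R = S ∨ R = T := by
  obtain ⟨a, b, ha, hb, hab, h⟩ := h
  have key : ∀ i, a * (if i ∈ S then 1 else 0) + b * (if i ∈ T then 1 else 0) =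
      if i ∈ R then 1 else 0 := fun i => by simpa [indicatorVec] using congrFun h i
  by_cases ha0 : a = 0
  · right
    apply indicatorVec_injective
    rw [← h, ha0, show b = 1 by linarith]
    simp
  by_cases hb0 : b = 0
  · left
    apply indicatorVec_injective
    rw [← h, hb0, show a = 1 by linarith]
    simp
  left
  ext i
  have ha' := ha.lt_of_ne' ha0
  have hb' := hb.lt_of_ne' hb0
  have := key i
  by_cases h1 : i ∈ S <;> by_cases h2 : i ∈ T <;> by_cases h3 : i ∈ R <;>
    simp only [h1, h2, h3, if_true, if_false] at this ⊢ <;> linarith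

theorem indicatorVec_insert {i : Fin n} {S : Finset (Fin n)} (h : i ∉ S) :
    indicatorVec (insert i S) = indicatorVec S + Pi.single i 1 := by
  ext j
  by_cases hj : j = i
  · subst hj; simp [indicatorVec, h]
  · simp [indicatorVec, hj]

theorem indicatorVec_erase {i : Fin n} {S : Finset (Fin n)} (h : i ∈ S) :
    indicatorVec (S.erase i) = indicatorVec S - Pi.single i 1 := by
  rw [eq_sub_iff_add_eq, ← indicatorVec_insert (Finset.notMem_erase i S), Finset.insert_erase h]

theorem left_mem_extremePoints_segment {x y : Fin n → ℝ} (hxy : x ≠ y) :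
    x ∈ (segment ℝ x y).extremePoints ℝ := by
  refine mem_extremePoints_iff_left.2 ⟨left_mem_segment ℝ _ _, fun x₁ h₁ x₂ h₂ h => ?_⟩
  rw [segment_eq_image'] at h₁ h₂
  obtain ⟨s, hs, rfl⟩ := h₁
  obtain ⟨t, ht, rfl⟩ := h₂
  obtain ⟨a, b, ha, hb, hab, h⟩ := h
  obtain ⟨i, hi⟩ := Function.ne_iff.1 hxy
  have h' := congrFun h i
  simp only [Pi.add_apply, Pi.smul_apply, Pi.sub_apply, smul_eq_mul] at h'
  have h0 : (a * s + b * t) * (y i - x i) = 0 := by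
    have : b = 1 - a := by linarith
    subst this
    linarith
  have h1 : a * s + b * t = 0 :=
    (mul_eq_zero.1 h0).resolve_right (sub_ne_zero.2 (Ne.symm hi))
  have h2 : 0 ≤ a * s := mul_nonneg ha.le hs.1
  have h3 : 0 ≤ b * t := mul_nonneg hb.le ht.1
  have h4 : s = 0 := (mul_eq_zero.1 (by linarith : a * s = 0)).resolve_left ha.ne'
  simp [h4]

/-- The two sets produced by an exchange have the same total indicator vector and at least the same
total utility as `S` and `T`. So both are demanded, the functional exposing the edge is maximal at
both, and they lie on the edge. A segment contains no 0/1 vectors besides 0/1 endpoints. -/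
theorem exchange_of_isEdge {u : ItemValuation n} (hu : IsExchangeable u.val) {p : Fin n → ℝ}
    {S T : Finset (Fin n)} (hS : S ∈ u.demand p) (hT : T ∈ u.demand p)
    (hF : IsExposed ℝ (u.face p) (segment ℝ (indicatorVec S) (indicatorVec T)))
    {i : Fin n} (hiS : i ∈ S) (hiT : i ∉ T) :
    T = S.erase i ∨ ∃ j, j ∉ S ∧ T = insert j (S.erase i) := by
  obtain ⟨l, hl⟩ := hF ⟨_, left_mem_segment ℝ _ _⟩
  have hSl : indicatorVec S ∈ {x | x ∈ u.face p ∧ ∀ y ∈ u.face p, l y ≤ l x} :=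
    hl ▸ left_mem_segment ℝ _ _
  have hTl : indicatorVec T ∈ {x | x ∈ u.face p ∧ ∀ y ∈ u.face p, l y ≤ l x} :=
    hl ▸ right_mem_segment ℝ _ _
  have key : ∀ S' T' : Finset (Fin n), S' ⊆ u.ground → T' ⊆ u.ground →
      u.utility p S + u.utility p T ≤ u.utility p S' + u.utility p T' →
      indicatorVec S' + indicatorVec T' = indicatorVec S + indicatorVec T →
      S' = S ∨ S' = T := by
    intro S' T' hS' hT' h1 h2
    have hmem : ∀ R ∈ u.demand p, indicatorVec R ∈ u.face p := fun R hR =>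
      subset_convexHull ℝ _ ⟨R, hR, rfl⟩
    have hS'' : S' ∈ u.demand p := by
      refine ⟨hS', fun R hR => ?_⟩
      have := hS.2 R hR
      have := hT.2 T' hT'
      linarith
    have hT'' : T' ∈ u.demand p := by
      refine ⟨hT', fun R hR => ?_⟩
      have := hT.2 R hR
      have := hS.2 S' hS'
      linarith
    apply indicatorVec_eq_of_mem_segment
    rw [hl]
    refine ⟨hmem _ hS'', fun y hy => ?_⟩
    have h3 := congrArg l h2
    rw [map_add, map_add] at h3
    have := hSl.2 y hy
    have := hTl.2 _ (hmem T' hT'')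
    linarith
  rcases hu.sub_sum p S T i hiS hiT with h | ⟨j, hjT, hjS, h⟩
  · have := key (S.erase i) (insert i T) ((Finset.erase_subset _ _).trans hS.1)
      (Finset.insert_subset (hS.1 hiS) hT.1) h
      (by rw [indicatorVec_erase hiS, indicatorVec_insert hiT]; abel)
    grind
  · have hij : i ≠ j := fun h => hiT (h ▸ hjT)
    have := key (insert j (S.erase i)) (insert i (T.erase j))
      (Finset.insert_subset (hT.1 hjT) ((Finset.erase_subset _ _).trans hS.1))
      (Finset.insert_subset (hS.1 hiS) ((Finset.erase_subset _ _).trans hT.1)) h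
      (by
        rw [indicatorVec_insert (by grind), indicatorVec_insert (by grind),
          indicatorVec_erase hiS, indicatorVec_erase hjT]
        abel)
    grind

theorem isGrossSubstitutes_of_isExchangeable {u : ItemValuation n} (hu : IsExchangeable u.val) :
    u.IsGrossSubstitutes := by
  intro p x y hxy
  obtain ⟨hne, hF⟩ := hxy
  -- Endpoints of an exposed segment are extreme points of the face, hence indicator vectors of
  -- demanded sets.
  have hvert : ∀ z ∈ (segment ℝ x y).extremePoints ℝ, ∃ R ∈ u.demand p, indicatorVec R = z :=
    fun z hz => extremePoints_convexHull_subset (𝕜 := ℝ) (A := indicatorVec '' u.demand p)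
      (hF.isExtreme.extremePoints_subset_extremePoints hz)
  obtain ⟨S, hS, rfl⟩ := hvert x (left_mem_extremePoints_segment hne)
  obtain ⟨T, hT, rfl⟩ := hvert y (by
    rw [segment_symm]
    exact left_mem_extremePoints_segment hne.symm)
  have hST : S ≠ T := fun h => hne (h ▸ rfl)
  by_cases hsub : S ⊆ T
  · obtain ⟨i, hiT, hiS⟩ : ∃ i ∈ T, i ∉ S := by
      by_contra! h
      exact hST (hsub.antisymm h)
    rw [segment_symm] at hF
    have hTi : S = T.erase i := by
      rcases exchange_of_isEdge hu hT hS hF hiT hiS with h | ⟨j, hjT, h⟩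
      · exact h
      · exact absurd (hsub (h ▸ Finset.mem_insert_self j _)) hjT
    refine Or.inl ⟨i, 1, ?_⟩
    rw [hTi, indicatorVec_erase hiT, one_smul]
    abel
  · obtain ⟨i, hiS, hiT⟩ := Finset.not_subset.1 hsub
    rcases exchange_of_isEdge hu hS hT hF hiS hiT with h | ⟨j, hjS, h⟩
    · refine Or.inl ⟨i, -1, ?_⟩
      rw [h, indicatorVec_erase hiS]
      simp
    · refine Or.inr ⟨j, i, 1, fun hij => hjS (hij ▸ hiS), ?_⟩
      rw [h, indicatorVec_insert (by simp [hjS]), indicatorVec_erase hiS, one_smul]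
      abel

end ItemValuation

theorem Finset.eq_of_subset_triple {α : Type*} [DecidableEq α] {x y z : α} {R : Finset α}
    (hR : R ⊆ {x, y, z}) : R = ∅ ∨ R = {x} ∨ R = {y} ∨ R = {z} ∨ R = {x, y} ∨ R = {x, z} ∨
      R = {y, z} ∨ R = {x, y, z} := by
  have h : R = ({x, y, z} : Finset α).filter (· ∈ R) := by
    ext i
    rw [Finset.mem_filter]
    exact ⟨fun hi => ⟨hR hi, hi⟩, And.right⟩
  by_cases hx : x ∈ R <;> by_cases hy : y ∈ R <;> by_cases hz : z ∈ R <;>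
    simp only [Finset.filter_insert, Finset.filter_singleton, hx, hy, hz, if_true, if_false,
      insert_empty_eq] at h <;> tauto

namespace ItemValuation

variable {n : ℕ}

/-! ### Partition valuations are not matroid based -/

theorem endow_empty (u : ItemValuation n) : endow u ∅ = u := by
  ext <;> simp [endow, u.val_empty]

theorem eq_of_forall_val_singleton {u v : ItemValuation n} (hv : IsExchangeable v.val)
    (hground : v.ground ⊆ u.ground) (h : ∀ i, v.val {i} = 0) : merge u v = u := by
  have h0 : ∀ S, v.val S = 0 := hv.eq_zero_of_singleton v.val_empty v.val_mono h
  ext S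
  · simp only [merge, Finset.mem_union]
    exact ⟨fun h => h.elim id (@hground _), Or.inl⟩
  · apply le_antisymm
    · obtain ⟨X, hX, h⟩ := exists_merge_eq u v S
      rw [h, h0, add_zero]
      exact u.val_mono _ _ hX
    · have := le_merge u v (Finset.Subset.refl S)
      rwa [h0, add_zero] at this

theorem merge_comm (u v : ItemValuation n) : merge u v = merge v u := by
  have key : ∀ (u v : ItemValuation n) S, (merge u v).val S ≤ (merge v u).val S := by
    intro u v S
    obtain ⟨X, hX, h⟩ := exists_merge_eq u v S
    rw [h, add_comm]
    refine le_trans (le_of_eq ?_) (le_merge v u (Finset.sdiff_subset (s := S) (t := X)))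
    rw [Finset.sdiff_sdiff_eq_self hX]
  ext S
  · simp only [merge, Finset.mem_union, or_comm]
  · exact le_antisymm (key u v S) (key v u S)

theorem mem_ground_of_val_singleton_ne_zero {u : ItemValuation n} {i : Fin n}
    (h : u.val {i} ≠ 0) : i ∈ u.ground := by
  by_contra hi
  apply h
  rw [← u.val_inter, Finset.singleton_inter_of_notMem hi, u.val_empty]

section PartitionValuation

variable {π : Finpartition (Finset.univ : Finset (Fin n))} {a b : ℝ} {ha : 0 < a} {hab : a < b}

theorem partitionValuation_of_subset {P I : Finset (Fin n)} (hP : P ∈ π.parts)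
    (hI : I.Nonempty) (hIP : I ⊆ P) : (partitionValuation π a b ha hab).val I = a := by
  have : ∃ P ∈ π.parts, I ⊆ P := ⟨P, hP, hIP⟩
  simp [partitionValuation, hI.ne_empty, this]

theorem partitionValuation_le (I : Finset (Fin n)) :
    (partitionValuation π a b ha hab).val I ≤ b := by
  simp only [partitionValuation]
  split_ifs <;> linarith

theorem partitionValuation_singleton (i : Fin n) :
    (partitionValuation π a b ha hab).val {i} = a :=
  partitionValuation_of_subset (π.part_mem.2 (Finset.mem_univ i)) (Finset.singleton_nonempty i)
    (by simp)

theorem partitionValuation_univ (hπ : 2 ≤ π.parts.card) :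
    (partitionValuation π a b ha hab).val Finset.univ = b := by
  obtain ⟨P, hP, Q, hQ, hPQ⟩ := Finset.one_lt_card.1 hπ
  have h0 : (Finset.univ : Finset (Fin n)) ≠ ∅ := by
    obtain ⟨i, -⟩ := π.nonempty_of_mem_parts hP
    exact Finset.ne_empty_of_mem (Finset.mem_univ i)
  have h1 : ¬ ∃ R ∈ π.parts, Finset.univ ⊆ R := by
    rintro ⟨R, hR, hsub⟩
    have : ∀ P ∈ π.parts, P = R := fun P hP => by
      obtain ⟨i, hi⟩ := π.nonempty_of_mem_parts hP
      exact π.eq_of_mem_parts hP hR hi (hsub (Finset.mem_univ i))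
    exact hPQ ((this P hP).trans (this Q hQ).symm)
  simp only [partitionValuation]
  rw [if_neg h0, if_neg h1]

/-- Since `b < 2 * a`, no other item can have value `a` under `v` once `i₀` has it under `u`; hence
`u` gives `a` to all singletons. An item and its partner in the same part are worth only `a`
together, which leaves 0 for `v`. -/
theorem eq_partitionValuation_of_merge_eq {u v : ItemValuation n} (hv : IsExchangeable v.val)
    (hb : b < 2 * a) (hcard : ∀ P ∈ π.parts, 2 ≤ P.card)
    (h : merge u v = partitionValuation π a b ha hab) {i₀ : Fin n} (hi₀ : u.val {i₀} = a) :
    u = partitionValuation π a b ha hab := by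
  have hpartner : ∀ i, ∃ j, j ≠ i ∧ (partitionValuation π a b ha hab).val {j, i} = a := by
    intro i
    have hP := π.part_mem.2 (Finset.mem_univ i)
    obtain ⟨j, hj, hji⟩ := Finset.exists_mem_ne (hcard _ hP) i
    refine ⟨j, hji, partitionValuation_of_subset hP (by simp) ?_⟩
    simp [Finset.insert_subset_iff, hj]
  have hpair : ∀ i j, i ≠ j → u.val {i} + v.val {j} ≤
      (partitionValuation π a b ha hab).val {i, j} := by
    intro i j hij
    have := le_merge u v (X := {i}) (S := {i, j}) (by simp)
    rwa [h, show ({i, j} : Finset (Fin n)) \ {i} = {j} by grind] at this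
  have hsingle : ∀ i, u.val {i} = a ∨ v.val {i} = a := by
    intro i
    obtain ⟨X, hX, hX'⟩ := exists_merge_eq u v {i}
    rw [h, partitionValuation_singleton] at hX'
    rcases Finset.subset_singleton_iff.1 hX with rfl | rfl
    · rw [u.val_empty, zero_add, Finset.sdiff_empty] at hX'
      exact Or.inr hX'.symm
    · rw [Finset.sdiff_self, v.val_empty, add_zero] at hX'
      exact Or.inl hX'.symm
  have hexcl : ∀ i j, i ≠ j → u.val {i} = a → v.val {j} ≠ a := by
    intro i j hij hi hj
    have := hpair i j hij
    have := partitionValuation_le (π := π) (ha := ha) (hab := hab) {i, j}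
    linarith
  have hu : ∀ i, u.val {i} = a := by
    intro i
    by_cases hi : i = i₀
    · rw [hi, hi₀]
    · exact (hsingle i).resolve_right (hexcl i₀ i (Ne.symm hi) hi₀)
  have hv0 : ∀ i, v.val {i} = 0 := by
    intro i
    obtain ⟨j, hji, hj⟩ := hpartner i
    have h1 := hpair j i hji
    have h2 := v.val_mono ∅ {i} (by simp)
    rw [v.val_empty] at h2
    linarith [hu j]
  rw [← h]
  refine (eq_of_forall_val_singleton hv (fun i _ => ?_) hv0).symm
  exact mem_ground_of_val_singleton_ne_zero (by rw [hu i]; exact ha.ne')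

theorem weightedRank_ne_partitionValuation (M : Matroid (Fin n)) (w : Fin n → NNReal)
    (hb : b < 2 * a) (hπ : 2 ≤ π.parts.card) :
    weightedRank M w ≠ partitionValuation π a b ha hab := by
  intro h
  have hw : ∀ i, (w i : ℝ) = a := by
    intro i
    obtain ⟨I, hI, -, hval⟩ := exists_weightedRank_eq M w {i}
    rw [h, partitionValuation_singleton] at hval
    rcases Finset.subset_singleton_iff.1 hI with rfl | rfl
    · rw [Finset.sum_empty] at hval
      exact absurd hval ha.ne'
    · rw [Finset.sum_singleton] at hval
      exact hval.symm
  obtain ⟨I, -, -, hval⟩ := exists_weightedRank_eq M w Finset.univ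
  rw [h, partitionValuation_univ hπ, Finset.sum_congr rfl fun i _ => hw i, Finset.sum_const,
    nsmul_eq_mul] at hval
  have h1 : 1 < I.card := by
    by_contra! hc
    have : (I.card : ℝ) ≤ 1 := by exact_mod_cast hc
    nlinarith
  have h2 : (2 : ℝ) ≤ I.card := by exact_mod_cast h1
  nlinarith

theorem not_isMatroidBased_partitionValuation (hb : b < 2 * a) (hπ : 2 ≤ π.parts.card)
    (hcard : ∀ P ∈ π.parts, 2 ≤ P.card) :
    ¬ (partitionValuation π a b ha hab).IsMatroidBased := by
  suffices h : ∀ u : ItemValuation n, u.IsMatroidBased → u ≠ partitionValuation π a b ha hab from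
    fun hm => h _ hm rfl
  intro u hu
  induction hu with
  | weightedRank M w => exact weightedRank_ne_partitionValuation M w hb hπ
  | merge u v hu hv ihu ihv =>
    intro h
    obtain ⟨P, hP⟩ := Finset.card_pos.1 (by omega : 0 < π.parts.card)
    obtain ⟨i, -⟩ := π.nonempty_of_mem_parts hP
    have hi := partitionValuation_singleton (π := π) (ha := ha) (hab := hab) i
    obtain ⟨X, hX, hX'⟩ := exists_merge_eq u v {i}
    rw [h, hi] at hX'
    rcases Finset.subset_singleton_iff.1 hX with rfl | rfl
    · rw [u.val_empty, zero_add, Finset.sdiff_empty] at hX'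
      rw [merge_comm] at h
      exact ihv (eq_partitionValuation_of_merge_eq hu.isExchangeable hb hcard h hX'.symm)
    · rw [Finset.sdiff_self, v.val_empty, add_zero] at hX'
      exact ihu (eq_partitionValuation_of_merge_eq hv.isExchangeable hb hcard h hX'.symm)
  -- The resulting ground set is everything, so nothing was endowed.
  | endow u T hT _ ih =>
    intro h
    have hg : u.ground \ T = Finset.univ := congrArg ground h
    have hT0 : T = ∅ := by
      refine Finset.eq_empty_of_forall_notMem fun i hi => ?_
      have := hg ▸ Finset.mem_univ i
      exact (Finset.mem_sdiff.1 this).2 hi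
    rw [hT0, endow_empty] at h
    exact ih h

theorem exists_finpartition_two_le (hn : 4 ≤ n) :
    ∃ π : Finpartition (Finset.univ : Finset (Fin n)),
      2 ≤ π.parts.card ∧ ∀ P ∈ π.parts, 2 ≤ P.card := by
  let A : Finset (Fin n) := {⟨0, by omega⟩, ⟨1, by omega⟩}
  have hA : A.card = 2 := Finset.card_pair (by simp)
  have hAc : 2 ≤ Aᶜ.card := by
    rw [Finset.card_compl, hA, Fintype.card_fin]
    omega
  have hA0 : A ≠ ⊥ := fun h => by
    rw [h] at hA
    simp at hA
  have hAc0 : Aᶜ ≠ ⊥ := fun h => by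
    rw [h] at hAc
    simp at hAc
  refine ⟨(Finpartition.indiscrete hA0).extend hAc0 disjoint_compl_right
    (by simp), ?_, ?_⟩
  · rw [Finpartition.card_extend]
    simp
  · intro P hP
    simp only [Finpartition.extend_parts, Finpartition.indiscrete_parts, Finset.mem_insert,
      Finset.mem_singleton] at hP
    rcases hP with rfl | rfl
    · exact hAc
    · exact hA.ge

end PartitionValuation

/-! ### Inequalities satisfied by gross substitutes valuations -/

theorem exists_mem_demand (u : ItemValuation n) (p : Fin n → ℝ) : ∃ T, T ∈ u.demand p := by
  obtain ⟨T, hT, h⟩ := Finset.exists_max_image u.ground.powerset (u.utility p)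
    ⟨∅, Finset.empty_mem_powerset _⟩
  exact ⟨T, Finset.mem_powerset.1 hT, fun T' hT' => h T' (Finset.mem_powerset.2 hT')⟩

theorem isEdge_of_demand_eq_pair {u : ItemValuation n} {p : Fin n → ℝ} {S T : Finset (Fin n)}
    (hST : S ≠ T) (h : u.demand p = {S, T}) :
    IsEdge (u.face p) (indicatorVec S) (indicatorVec T) := by
  refine ⟨fun h' => hST (indicatorVec_injective h'), ?_⟩
  rw [face, h, Set.image_pair, convexHull_pair]

/-- Prices that force all demanded sets to lie between `S` and `U`, and equal `q` on `U \ S`. -/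
noncomputable def pinnedPrice (u : ItemValuation n) (S U : Finset (Fin n)) (q : Fin n → ℝ)
    (i : Fin n) : ℝ :=
  if i ∈ S then -1 else if i ∈ U then q i else u.val u.ground + 1

/-- By monotonicity, an item of price -1 is always strictly worth adding. A price of `u.val u.ground
+ 1` exceeds every possible gain. -/
theorem subset_of_mem_demand_pinnedPrice {u : ItemValuation n} {S U T : Finset (Fin n)}
    {q : Fin n → ℝ} (hSU : S ⊆ U) (hS : S ⊆ u.ground) (hT : T ∈ u.demand (pinnedPrice u S U q)) :
    S ⊆ T ∧ T ⊆ U := by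
  constructor
  · intro i hi
    by_contra hiT
    have h1 := hT.2 (insert i T) (Finset.insert_subset (hS hi) hT.1)
    have h2 := u.val_mono T (insert i T) (Finset.subset_insert _ _)
    have h3 : pinnedPrice u S U q i = -1 := if_pos hi
    rw [utility, utility, Finset.sum_insert hiT, h3] at h1
    linarith
  · intro i hi
    by_contra hiU
    have h1 := hT.2 (T.erase i) ((Finset.erase_subset _ _).trans hT.1)
    have h2 := u.val_mono T u.ground hT.1
    have h3 : pinnedPrice u S U q i = u.val u.ground + 1 := by
      rw [pinnedPrice, if_neg fun h => hiU (hSU h), if_neg hiU]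
    have h4 := Finset.add_sum_erase T (pinnedPrice u S U q) hi
    have h5 := u.val_mono ∅ (T.erase i) (Finset.empty_subset _)
    rw [u.val_empty] at h5
    rw [utility, utility] at h1
    linarith

theorem utility_pinnedPrice {u : ItemValuation n} {S U R : Finset (Fin n)}
    {q : Fin n → ℝ} (hR : R ⊆ U \ S) :
    u.utility (pinnedPrice u S U q) (S ∪ R) = u.val (S ∪ R) - ∑ i ∈ R, q i + S.card := by
  have hdisj : Disjoint S R := by
    rw [Finset.disjoint_left]
    exact fun i hi hiR => (Finset.mem_sdiff.1 (hR hiR)).2 hi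
  have h1 : ∑ i ∈ S, pinnedPrice u S U q i = ∑ i ∈ S, (-1) :=
    Finset.sum_congr rfl fun i hi => if_pos hi
  have h2 : ∑ i ∈ R, pinnedPrice u S U q i = ∑ i ∈ R, q i :=
    Finset.sum_congr rfl fun i hi => by
      have := Finset.mem_sdiff.1 (hR hi)
      rw [pinnedPrice, if_neg this.2, if_pos this.1]
  rw [utility, Finset.sum_union hdisj, h1, h2, Finset.sum_const, nsmul_eq_mul]
  ring

/-- Under the pinned prices exactly two sets are demanded, so the face is a segment and its own
edge. This turns gross substitutes into inequalities: a strict violation supplies prices at which a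
forbidden pair is the whole demand. -/
theorem IsGrossSubstitutes.indicatorVec_sub {u : ItemValuation n} (hu : u.IsGrossSubstitutes)
    {S U R₁ R₂ : Finset (Fin n)} (q : Fin n → ℝ) (hSU : S ⊆ U) (hU : U ⊆ u.ground)
    (hR₁ : R₁ ⊆ U \ S) (hR₂ : R₂ ⊆ U \ S) (hne : R₁ ≠ R₂)
    (heq : u.val (S ∪ R₁) - ∑ i ∈ R₁, q i = u.val (S ∪ R₂) - ∑ i ∈ R₂, q i)
    (hlt : ∀ R ⊆ U \ S, R ≠ R₁ → R ≠ R₂ →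
      u.val (S ∪ R) - ∑ i ∈ R, q i < u.val (S ∪ R₁) - ∑ i ∈ R₁, q i) :
    (∃ (i : Fin n) (c : ℝ), indicatorVec R₂ - indicatorVec R₁ = c • (Pi.single i 1 : Fin n → ℝ)) ∨
    (∃ (i j : Fin n) (c : ℝ), i ≠ j ∧ indicatorVec R₂ - indicatorVec R₁ =
      c • ((Pi.single i 1 : Fin n → ℝ) - Pi.single j 1)) := by
  set p := pinnedPrice u S U q with hp
  have hsub : ∀ R ⊆ U \ S, S ∪ R ⊆ u.ground := fun R hR =>
    (Finset.union_subset hSU (hR.trans Finset.sdiff_subset)).trans hU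
  have hmem : ∀ T ∈ u.demand p, T = S ∪ R₁ ∨ T = S ∪ R₂ := by
    intro T hT
    obtain ⟨hST, hTU⟩ := subset_of_mem_demand_pinnedPrice hSU (hSU.trans hU) hT
    have hTS : S ∪ T \ S = T := Finset.union_sdiff_of_subset hST
    by_contra! hcon
    have h1 := hlt (T \ S) (Finset.sdiff_subset_sdiff hTU le_rfl)
      (fun h => hcon.1 (by rw [← hTS, h])) (fun h => hcon.2 (by rw [← hTS, h]))
    have h2 := hT.2 _ (hsub R₁ hR₁)
    rw [← hTS, hp, utility_pinnedPrice hR₁,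
      utility_pinnedPrice (Finset.sdiff_subset_sdiff hTU le_rfl)] at h2
    linarith
  have hutil : u.utility p (S ∪ R₁) = u.utility p (S ∪ R₂) := by
    rw [hp, utility_pinnedPrice hR₁, utility_pinnedPrice hR₂, heq]
  have hdemand : u.demand p = {S ∪ R₁, S ∪ R₂} := by
    obtain ⟨T, hT⟩ := u.exists_mem_demand p
    have hTu : u.utility p T = u.utility p (S ∪ R₁) := by
      rcases hmem T hT with rfl | rfl
      · rfl
      · exact hutil.symm
    ext R
    refine ⟨hmem R, ?_⟩
    rintro (rfl | rfl)
    · exact ⟨hsub _ hR₁, fun T' hT' => hTu ▸ hT.2 T' hT'⟩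
    · exact ⟨hsub _ hR₂, fun T' hT' => hutil ▸ hTu ▸ hT.2 T' hT'⟩
  have hne' : S ∪ R₁ ≠ S ∪ R₂ := by
    intro h
    apply hne
    have : ∀ R ⊆ U \ S, (S ∪ R) \ S = R := by grind
    rw [← this R₁ hR₁, ← this R₂ hR₂, h]
  have hvec : ∀ R ⊆ U \ S, indicatorVec (S ∪ R) = indicatorVec S + indicatorVec R := by
    intro R hR
    ext i
    have := @hR i
    by_cases h1 : i ∈ S <;> by_cases h2 : i ∈ R <;> simp_all [indicatorVec]
  have := hu p _ _ (isEdge_of_demand_eq_pair hne' hdemand)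
  rwa [hvec R₁ hR₁, hvec R₂ hR₂, add_sub_add_left_eq_sub] at this

theorem not_parallel_of_eq_one {v : Fin n → ℝ} {i j : Fin n} (hij : i ≠ j) (hi : v i = 1)
    (hj : v j = 1) : ¬ ((∃ (k : Fin n) (c : ℝ), v = c • (Pi.single k 1 : Fin n → ℝ)) ∨
    (∃ (k l : Fin n) (c : ℝ), k ≠ l ∧
      v = c • ((Pi.single k 1 : Fin n → ℝ) - Pi.single l 1))) := by
  rintro (⟨k, c, rfl⟩ | ⟨k, l, c, hkl, rfl⟩)
  · simp only [Pi.smul_apply, Pi.single_apply, smul_eq_mul] at hi hj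
    split_ifs at hi hj with h1 h2
    · exact hij (h1.trans h2.symm)
    all_goals linarith
  · simp only [Pi.sub_apply, Pi.smul_apply, Pi.single_apply, smul_eq_mul] at hi hj
    split_ifs at hi hj <;> first | linarith | (exfalso; grind)

theorem IsGrossSubstitutes.submodular_of_subset {u : ItemValuation n} (hu : u.IsGrossSubstitutes)
    {S : Finset (Fin n)} {i j : Fin n} (hiS : i ∉ S) (hjS : j ∉ S) (hij : i ≠ j)
    (hS : insert i (insert j S) ⊆ u.ground) :
    u.val (insert i (insert j S)) + u.val S ≤ u.val (insert i S) + u.val (insert j S) := by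
  by_contra! hlt
  set d := u.val (insert i (insert j S)) + u.val S - u.val (insert i S) - u.val (insert j S) with hd
  have hd0 : 0 < d := by linarith
  -- Each price exceeds the marginal value over `S` by `d / 2`: adding one item loses `d / 2`, while
  -- adding both ties with adding none.
  let q : Fin n → ℝ := fun k =>
    (if k = i then u.val (insert i S) else u.val (insert j S)) - u.val S + d / 2
  have hqi : q i = u.val (insert i S) - u.val S + d / 2 := by simp [q]
  have hqj : q j = u.val (insert j S) - u.val S + d / 2 := by simp [q, hij.symm]
  have e1 : S ∪ {i} = insert i S := by grind
  have e2 : S ∪ {j} = insert j S := by grind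
  have e3 : S ∪ {i, j} = insert i (insert j S) := by grind
  have hU : insert i (insert j S) \ S = {i, j} := by grind
  have key := hu.indicatorVec_sub (S := S) (U := insert i (insert j S)) (R₁ := ∅) (R₂ := {i, j}) q
    (by grind) hS (by simp) (by rw [hU]) (Finset.insert_ne_empty i {j}).symm
    (by
      rw [e3, Finset.sum_pair hij, hqi, hqj, Finset.union_empty, Finset.sum_empty]
      linarith)
    (by
      rw [hU]
      intro R hR h1 h2
      have : R = {i} ∨ R = {j} := by grind
      rw [Finset.union_empty, Finset.sum_empty]
      rcases this with rfl | rfl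
      · rw [e1, Finset.sum_singleton, hqi]
        linarith
      · rw [e2, Finset.sum_singleton, hqj]
        linarith)
  exact not_parallel_of_eq_one hij (by simp [indicatorVec]) (by simp [indicatorVec]) key

theorem val_eq_of_inter_eq (u : ItemValuation n) {S T : Finset (Fin n)}
    (h : S ∩ u.ground = T ∩ u.ground) : u.val S = u.val T := by
  rw [← u.val_inter S, h, u.val_inter]

theorem val_insert_of_notMem (u : ItemValuation n) {i : Fin n} (hi : i ∉ u.ground)
    (S : Finset (Fin n)) : u.val (insert i S) = u.val S :=
  u.val_eq_of_inter_eq (Finset.insert_inter_of_notMem hi)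

theorem IsGrossSubstitutes.submodular {u : ItemValuation n} (hu : u.IsGrossSubstitutes)
    {S : Finset (Fin n)} {i j : Fin n} (hiS : i ∉ S) (hjS : j ∉ S) (hij : i ≠ j) :
    u.val (insert i (insert j S)) + u.val S ≤ u.val (insert i S) + u.val (insert j S) := by
  by_cases hi : i ∈ u.ground
  · by_cases hj : j ∈ u.ground
    · have := hu.submodular_of_subset (S := S ∩ u.ground) (by grind) (by grind) hij (by grind)
      convert this using 2 <;> apply u.val_eq_of_inter_eq <;> grind
    · rw [Finset.insert_comm, u.val_insert_of_notMem hj, u.val_insert_of_notMem hj]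
  · rw [u.val_insert_of_notMem hi, u.val_insert_of_notMem hi, add_comm]

theorem IsGrossSubstitutes.val_pair_le {u : ItemValuation n} (hu : u.IsGrossSubstitutes)
    {i j : Fin n} (hij : i ≠ j) : u.val {i, j} ≤ u.val {i} + u.val {j} := by
  have := hu.submodular (S := ∅) (by simp) (by simp) hij
  rwa [u.val_empty, add_zero] at this

theorem IsGrossSubstitutes.val_triple_le {u : ItemValuation n} (hu : u.IsGrossSubstitutes)
    {x y z : Fin n} (hxy : x ≠ y) (hxz : x ≠ z) (hyz : y ≠ z) :
    u.val {x, y, z} + u.val {z} ≤ u.val {x, z} + u.val {y, z} :=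
  hu.submodular (S := {z}) (by simpa) (by simpa) hxy

theorem IsGrossSubstitutes.val_pair_add_le_of_subset {u : ItemValuation n}
    (hu : u.IsGrossSubstitutes) {x y z : Fin n} (hxy : x ≠ y) (hxz : x ≠ z) (hyz : y ≠ z)
    (hU : {x, y, z} ⊆ u.ground) :
    u.val {y, z} + u.val {x} ≤ max (u.val {x, z} + u.val {y}) (u.val {x, y} + u.val {z}) := by
  by_contra! hlt
  obtain ⟨h1, h2⟩ := max_lt_iff.1 hlt
  set s := u.val {y, z} + u.val {x} - (u.val {x, z} + u.val {y}) with hs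
  set t := u.val {y, z} + u.val {x} - (u.val {x, y} + u.val {z}) with ht
  set m := u.val {y} + u.val {z} - u.val {y, z} + (s + t) / 2 with hm
  have hm0 : 0 < m := by
    have := hu.val_pair_le hyz
    linarith
  -- At these prices `{x}` and `{y, z}` have utility `m`. The empty set has 0, `{y}` and `{x, z}`
  -- have `m - s / 2`, `{z}` and `{x, y}` have `m - t / 2`, and by submodularity the triple has at
  -- most `m - (s + t) / 2`.
  let q : Fin n → ℝ := fun k =>
    if k = x then u.val {x} - m else if k = y then u.val {y} - m + s / 2
    else u.val {z} - m + t / 2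
  have hqx : q x = u.val {x} - m := by simp [q]
  have hqy : q y = u.val {y} - m + s / 2 := by simp [q, hxy.symm]
  have hqz : q z = u.val {z} - m + t / 2 := by simp [q, hxz.symm, hyz.symm]
  have hsub := hu.val_triple_le hyz hxy.symm hxz.symm
  have e1 : ({y, z, x} : Finset (Fin n)) = {x, y, z} := by grind
  rw [e1, Finset.pair_comm y x, Finset.pair_comm z x] at hsub
  have key := hu.indicatorVec_sub (S := ∅) (U := {x, y, z}) (R₁ := {x}) (R₂ := {y, z}) q
    (by simp) hU (by simp) (by simp) (by grind)
    (by
      rw [Finset.sum_pair hyz, Finset.sum_singleton, hqx, hqy, hqz, Finset.empty_union,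
        Finset.empty_union]
      linarith)
    (by
      intro R hR h1 h2
      rw [Finset.sdiff_empty] at hR
      have hcases : R = ∅ ∨ R = {y} ∨ R = {z} ∨ R = {x, y} ∨ R = {x, z} ∨ R = {x, y, z} := by
        have := Finset.eq_of_subset_triple hR
        tauto
      rw [Finset.empty_union, Finset.empty_union, Finset.sum_singleton, hqx]
      rcases hcases with rfl | rfl | rfl | rfl | rfl | rfl
      · rw [u.val_empty, Finset.sum_empty]
        linarith
      · rw [Finset.sum_singleton, hqy]
        linarith
      · rw [Finset.sum_singleton, hqz]
        linarith
      · rw [Finset.sum_pair hxy, hqx, hqy]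
        linarith
      · rw [Finset.sum_pair hxz, hqx, hqz]
        linarith
      · rw [Finset.sum_insert (by simp [hxy, hxz]), Finset.sum_pair hyz, hqx, hqy, hqz]
        linarith)
  exact not_parallel_of_eq_one hyz (by simp [indicatorVec, hxy.symm])
    (by simp [indicatorVec, hxz.symm]) key

theorem IsGrossSubstitutes.val_pair_add_le {u : ItemValuation n}
    (hu : u.IsGrossSubstitutes) {x y z : Fin n} (hxy : x ≠ y) (hxz : x ≠ z) (hyz : y ≠ z) :
    u.val {y, z} + u.val {x} ≤ max (u.val {x, z} + u.val {y}) (u.val {x, y} + u.val {z}) := by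
  by_cases hx : x ∈ u.ground
  · by_cases hy : y ∈ u.ground
    · by_cases hz : z ∈ u.ground
      · exact hu.val_pair_add_le_of_subset hxy hxz hyz (by grind)
      · refine le_max_of_le_left ?_
        rw [Finset.pair_comm y z, Finset.pair_comm x z, u.val_insert_of_notMem hz,
          u.val_insert_of_notMem hz, add_comm]
    · refine le_max_of_le_right ?_
      rw [Finset.pair_comm x y, u.val_insert_of_notMem hy, u.val_insert_of_notMem hy, add_comm]
  · refine le_max_of_le_left ?_
    rw [u.val_insert_of_notMem hx]
    have h1 := hu.val_pair_le hyz
    have h2 : u.val {x} = 0 := by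
      have := u.val_insert_of_notMem hx ∅
      rwa [u.val_empty] at this
    linarith

end ItemValuation

namespace ItemValuation

variable {n : ℕ}

/-! ### Merges of unit demand valuations -/

/-- The uniform matroid of rank one on `E`. -/
def rankOneOn (E : Finset (Fin n)) : Matroid (Fin n) :=
  (IndepMatroid.ofFinset (E := (E : Set (Fin n))) (Indep := fun I => I ⊆ E ∧ I.card ≤ 1)
    (indep_empty := by simp)
    (indep_subset := fun I J hJ hIJ => ⟨hIJ.trans hJ.1, (Finset.card_le_card hIJ).trans hJ.2⟩)
    (indep_aug := by
      intro I J hI hJ hIJ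
      have hI0 : I = ∅ := Finset.card_eq_zero.1 (by omega)
      obtain ⟨e, he⟩ := Finset.card_pos.1 (by omega : 0 < J.card)
      refine ⟨e, he, by simp [hI0], ?_, ?_⟩
      · rw [hI0]
        simpa using hJ.1 he
      · simp [hI0])
    (subset_ground := fun I hI => by simpa using hI.1)).matroid

theorem rankOneOn_indep {E I : Finset (Fin n)} :
    (rankOneOn E).Indep (I : Set (Fin n)) ↔ I ⊆ E ∧ I.card ≤ 1 := by
  simp [rankOneOn]

/-- The unit demand valuation on `E` with values `w`. -/
noncomputable def unitDemand (E : Finset (Fin n)) (w : Fin n → ℝ) : ItemValuation n :=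
  weightedRank (rankOneOn E) fun i => (w i).toNNReal

theorem unitDemand_ground (E : Finset (Fin n)) (w : Fin n → ℝ) : (unitDemand E w).ground = E := by
  ext i
  simp [unitDemand, weightedRank, rankOneOn]

theorem le_unitDemand {E : Finset (Fin n)} {w : Fin n → ℝ} (h0 : ∀ i ∉ E, w i = 0)
    {T : Finset (Fin n)} {i : Fin n} (hi : i ∈ T) : w i ≤ (unitDemand E w).val T := by
  by_cases hiE : i ∈ E
  · have := le_weightedRank (rankOneOn E) (fun i => (w i).toNNReal) (I := {i}) (T := T)
      (by simpa) (rankOneOn_indep.2 (by simpa))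
    rw [Finset.sum_singleton] at this
    exact (Real.le_coe_toNNReal _).trans this
  · rw [h0 i hiE, ← (unitDemand E w).val_empty]
    exact val_mono _ _ _ (Finset.empty_subset T)

theorem unitDemand_eq {E : Finset (Fin n)} {w : Fin n → ℝ} (hw : ∀ i, 0 ≤ w i)
    (T : Finset (Fin n)) :
    (unitDemand E w).val T = 0 ∨ ∃ i ∈ T, (unitDemand E w).val T = w i := by
  obtain ⟨I, hIT, hI, h⟩ := exists_weightedRank_eq (rankOneOn E) (fun i => (w i).toNNReal) T
  rcases I.eq_empty_or_nonempty with rfl | hne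
  · exact Or.inl (h.trans (Finset.sum_empty))
  · obtain ⟨i, rfl⟩ := Finset.card_eq_one.1
      (le_antisymm (rankOneOn_indep.1 hI).2 (Finset.card_pos.2 hne))
    refine Or.inr ⟨i, by simpa using hIT, h.trans ?_⟩
    rw [Finset.sum_singleton, Real.coe_toNNReal _ (hw i)]

/-- The merge of three unit demand valuations. -/
noncomputable def assignment (E : Finset (Fin n)) (w₁ w₂ w₃ : Fin n → ℝ) : ItemValuation n :=
  merge (merge (unitDemand E w₁) (unitDemand E w₂)) (unitDemand E w₃)

theorem assignment_isMatroidBased (E : Finset (Fin n)) (w₁ w₂ w₃ : Fin n → ℝ) :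
    (assignment E w₁ w₂ w₃).IsMatroidBased :=
  .merge _ _ (.merge _ _ (.weightedRank _ _) (.weightedRank _ _)) (.weightedRank _ _)

/-- As the weights decrease from `w₁` to `w₃`, an assignment that leaves some factor empty can be
shifted to the earlier factors, so bounds for initial segments of the factors are enough. -/
theorem assignment_le {u : ItemValuation n} {w₁ w₂ w₃ : Fin n → ℝ}
    (hw₃ : ∀ i, 0 ≤ w₃ i) (hw₂₃ : ∀ i, w₃ i ≤ w₂ i) (hw₁₂ : ∀ i, w₂ i ≤ w₁ i)
    (h1 : ∀ i, w₁ i ≤ u.val {i})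
    (h2 : ∀ i j, i ≠ j → w₁ i + w₂ j ≤ u.val {i, j})
    (h3 : ∀ i j k, i ≠ j → i ≠ k → j ≠ k → w₁ i + w₂ j + w₃ k ≤ u.val {i, j, k})
    (S : Finset (Fin n)) : (assignment u.ground w₁ w₂ w₃).val S ≤ u.val S := by
  have hw₂ : ∀ i, 0 ≤ w₂ i := fun i => (hw₃ i).trans (hw₂₃ i)
  have hw₁ : ∀ i, 0 ≤ w₁ i := fun i => (hw₂ i).trans (hw₁₂ i)
  obtain ⟨X, hX, hX'⟩ := exists_merge_eq
    (merge (unitDemand u.ground w₁) (unitDemand u.ground w₂)) (unitDemand u.ground w₃) S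
  obtain ⟨Y, hY, hY'⟩ := exists_merge_eq (unitDemand u.ground w₁) (unitDemand u.ground w₂) X
  rw [assignment, hX', hY']
  have h0 := u.val_mono ∅ S (Finset.empty_subset S)
  rw [u.val_empty] at h0
  have H1 : ∀ i ∈ S, w₁ i ≤ u.val S := fun i hi =>
    (h1 i).trans (u.val_mono _ _ (by simpa))
  have H2 : ∀ i ∈ S, ∀ j ∈ S, i ≠ j → w₁ i + w₂ j ≤ u.val S := fun i hi j hj hij =>
    (h2 i j hij).trans (u.val_mono _ _ (by grind))
  rcases unitDemand_eq (E := u.ground) hw₁ Y with ha | ⟨i, hi, ha⟩ <;>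
  rcases unitDemand_eq (E := u.ground) hw₂ (X \ Y) with hb | ⟨j, hj, hb⟩ <;>
  rcases unitDemand_eq (E := u.ground) hw₃ (S \ X) with hc | ⟨k, hk, hc⟩ <;>
  rw [ha, hb, hc]
  · linarith
  · linarith [H1 k (by grind), hw₂₃ k, hw₁₂ k]
  · linarith [H1 j (by grind), hw₁₂ j]
  · linarith [H2 j (by grind) k (by grind) (by grind), hw₁₂ j, hw₂₃ k]
  · linarith [H1 i (by grind)]
  · linarith [H2 i (by grind) k (by grind) (by grind), hw₂₃ k]
  · linarith [H2 i (by grind) j (by grind) (by grind)]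
  · exact (h3 i j k (by grind) (by grind) (by grind)).trans (u.val_mono _ _ (by grind))

section Lower

variable {E S : Finset (Fin n)} {w₁ w₂ w₃ : Fin n → ℝ}

theorem le_assignment₂ (h1 : ∀ i ∉ E, w₁ i = 0) (h2 : ∀ i ∉ E, w₂ i = 0) {i j : Fin n}
    (hi : i ∈ S) (hj : j ∈ S) (hij : i ≠ j) : w₁ i + w₂ j ≤ (assignment E w₁ w₂ w₃).val S := by
  have e1 := le_merge (merge (unitDemand E w₁) (unitDemand E w₂)) (unitDemand E w₃)
    (Finset.Subset.refl S)
  have e2 := le_merge (unitDemand E w₁) (unitDemand E w₂) (X := {i}) (S := S) (by simpa)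
  rw [Finset.sdiff_self, val_empty, add_zero] at e1
  have e3 := le_unitDemand h1 (Finset.mem_singleton_self i)
  have e4 := le_unitDemand h2 (T := S \ {i}) (i := j) (by grind)
  rw [assignment]
  linarith

theorem le_assignment₁ (h1 : ∀ i ∉ E, w₁ i = 0) {i : Fin n}
    (hi : i ∈ S) : w₁ i ≤ (assignment E w₁ w₂ w₃).val S := by
  have e1 := le_merge (merge (unitDemand E w₁) (unitDemand E w₂)) (unitDemand E w₃)
    (Finset.Subset.refl S)
  have e2 := le_merge (unitDemand E w₁) (unitDemand E w₂) (Finset.Subset.refl S)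
  rw [Finset.sdiff_self, val_empty, add_zero] at e1 e2
  exact (le_unitDemand h1 hi).trans (e2.trans e1)

theorem le_assignment₃ (h1 : ∀ i ∉ E, w₁ i = 0) (h2 : ∀ i ∉ E, w₂ i = 0)
    (h3 : ∀ i ∉ E, w₃ i = 0) {i j k : Fin n} (hi : i ∈ S) (hj : j ∈ S) (hk : k ∈ S)
    (hij : i ≠ j) (hik : i ≠ k) (hjk : j ≠ k) :
    w₁ i + w₂ j + w₃ k ≤ (assignment E w₁ w₂ w₃).val S := by
  have e1 := le_merge (merge (unitDemand E w₁) (unitDemand E w₂)) (unitDemand E w₃)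
    (X := {i, j}) (S := S) (by grind)
  have e2 := le_merge (unitDemand E w₁) (unitDemand E w₂) (X := {i}) (S := {i, j}) (by simp)
  have e3 := le_unitDemand h1 (Finset.mem_singleton_self i)
  have e4 := le_unitDemand h2 (T := {i, j} \ {i}) (i := j) (by grind)
  have e5 := le_unitDemand h3 (T := S \ {i, j}) (i := k) (by grind)
  rw [assignment]
  linarith

end Lower

theorem isMatroidBased_of_assignment {u : ItemValuation n} {w₁ w₂ w₃ : Fin n → ℝ}
    (hw₃ : ∀ i, 0 ≤ w₃ i) (hw₂₃ : ∀ i, w₃ i ≤ w₂ i) (hw₁₂ : ∀ i, w₂ i ≤ w₁ i)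
    (h1 : ∀ i, w₁ i ≤ u.val {i})
    (h2 : ∀ i j, i ≠ j → w₁ i + w₂ j ≤ u.val {i, j})
    (h3 : ∀ i j k, i ≠ j → i ≠ k → j ≠ k → w₁ i + w₂ j + w₃ k ≤ u.val {i, j, k})
    (hle : ∀ S : Finset (Fin n), S = ∅ ∨ (∃ i ∈ S, u.val S ≤ w₁ i) ∨
      (∃ i ∈ S, ∃ j ∈ S, i ≠ j ∧ u.val S ≤ w₁ i + w₂ j) ∨
      ∃ i ∈ S, ∃ j ∈ S, ∃ k ∈ S, i ≠ j ∧ i ≠ k ∧ j ≠ k ∧ u.val S ≤ w₁ i + w₂ j + w₃ k) :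
    u.IsMatroidBased := by
  have hw₂ : ∀ i, 0 ≤ w₂ i := fun i => (hw₃ i).trans (hw₂₃ i)
  have h01 : ∀ i ∉ u.ground, w₁ i = 0 := fun i hi => by
    have e1 := u.val_insert_of_notMem hi ∅
    rw [u.val_empty, insert_empty_eq] at e1
    linarith [h1 i, hw₂ i, hw₁₂ i]
  have h02 : ∀ i ∉ u.ground, w₂ i = 0 := fun i hi => by
    linarith [h01 i hi, hw₂ i, hw₁₂ i]
  have h03 : ∀ i ∉ u.ground, w₃ i = 0 := fun i hi => by
    linarith [h02 i hi, hw₃ i, hw₂₃ i]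
  have heq : u = assignment u.ground w₁ w₂ w₃ := by
    ext S
    · simp [assignment, merge, unitDemand_ground]
    · refine le_antisymm ?_ (assignment_le hw₃ hw₂₃ hw₁₂ h1 h2 h3 S)
      rcases hle S with rfl | ⟨i, hi, h⟩ | ⟨i, hi, j, hj, hij, h⟩ |
        ⟨i, hi, j, hj, k, hk, hij, hik, hjk, h⟩
      · rw [val_empty, val_empty]
      · exact h.trans (le_assignment₁ h01 hi)
      · exact h.trans (le_assignment₂ h01 h02 hi hj hij)
      · exact h.trans (le_assignment₃ h01 h02 h03 hi hj hk hij hik hjk)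
  rw [heq]
  exact assignment_isMatroidBased _ _ _ _

theorem val_nonneg (u : ItemValuation n) (S : Finset (Fin n)) : 0 ≤ u.val S := by
  rw [← u.val_empty]
  exact u.val_mono _ _ (Finset.empty_subset S)

/-! ### At most three items -/

theorem isMatroidBased_of_le_one (hn : n ≤ 1) (u : ItemValuation n) : u.IsMatroidBased := by
  have : Subsingleton (Fin n) := Fin.subsingleton_iff_le_one.2 hn
  refine isMatroidBased_of_assignment (w₁ := fun i => u.val {i}) (w₂ := 0) (w₃ := 0)
    (fun i => le_rfl) (fun i => le_rfl) (fun i => u.val_nonneg _) (fun i => le_rfl)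
    (fun i j hij => absurd (Subsingleton.elim i j) hij)
    (fun i j k hij => absurd (Subsingleton.elim i j) hij) fun S => ?_
  rcases S.eq_empty_or_nonempty with rfl | ⟨i, hi⟩
  · exact Or.inl rfl
  · refine Or.inr (Or.inl ⟨i, hi, ?_⟩)
    rw [show S = {i} from Finset.eq_singleton_iff_unique_mem.2
      ⟨hi, fun j _ => Subsingleton.elim j i⟩]

theorem IsGrossSubstitutes.isMatroidBased_of_eq_pair {u : ItemValuation n}
    (hu : u.IsGrossSubstitutes) {x y : Fin n} (hxy : x ≠ y) (huniv : ∀ i, i = x ∨ i = y) :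
    u.IsMatroidBased := by
  obtain ⟨w, hwx, hwy⟩ : ∃ w : Fin n → ℝ, w x = 0 ∧ w y = u.val {x, y} - u.val {x} :=
    ⟨fun i => if i = x then 0 else u.val {x, y} - u.val {x}, by simp, by simp [hxy.symm]⟩
  have hx := u.val_nonneg {x}
  have hxy1 := u.val_mono {x} {x, y} (by simp)
  have hxy2 := u.val_mono {y} {x, y} (by simp)
  have hsub := hu.val_pair_le hxy
  have hcomm := Finset.pair_comm x y
  refine isMatroidBased_of_assignment (w₁ := fun i => u.val {i}) (w₂ := w) (w₃ := 0)
    (fun i => le_rfl) ?_ ?_ (fun i => le_rfl) ?_ ?_ ?_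
  · intro i
    rcases huniv i with rfl | rfl
    · exact hwx.ge
    · rw [hwy]
      simpa using hxy1
  · intro i
    rcases huniv i with rfl | rfl
    · rw [hwx]
      exact hx
    · rw [hwy]
      linarith
  · intro i j hij
    rcases huniv i with rfl | rfl <;> rcases huniv j with rfl | rfl
    · exact absurd rfl hij
    · rw [hwy]
      linarith
    · rw [hwx, ← hcomm]
      linarith
    · exact absurd rfl hij
  · intro i j k hij hik hjk
    have hi := huniv i
    have hj := huniv j
    have hk := huniv k
    exfalso
    grind
  · intro S
    have hS := Finset.eq_of_subset_triple (x := x) (y := y) (z := y) (R := S)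
      fun i _ => by rcases huniv i with rfl | rfl <;> simp
    rw [Finset.pair_eq_singleton] at hS
    have : S = ∅ ∨ S = {x} ∨ S = {y} ∨ S = {x, y} := by tauto
    rcases this with rfl | rfl | rfl | rfl
    · exact Or.inl rfl
    · exact Or.inr (Or.inl ⟨x, by simp, le_rfl⟩)
    · exact Or.inr (Or.inl ⟨y, by simp, le_rfl⟩)
    · exact Or.inr (Or.inr (Or.inl ⟨x, by simp, y, by simp, hxy, by rw [hwy]; linarith⟩))

/-- The first factor takes the singleton values, the second the marginal values over `{x}`, the
third the marginal value of `z` over `{x, y}`. Then `heq` says that `{y, z}` is worth `y` in the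
first factor plus `z` in the second; `hle` keeps the opposite assignment from exceeding this.
Submodularity makes the weights decrease. -/
theorem IsGrossSubstitutes.isMatroidBased_of_val_eq {u : ItemValuation n}
    (hu : u.IsGrossSubstitutes) {x y z : Fin n} (hxy : x ≠ y) (hxz : x ≠ z) (hyz : y ≠ z)
    (huniv : ∀ i, i = x ∨ i = y ∨ i = z)
    (heq : u.val {y, z} + u.val {x} = u.val {x, z} + u.val {y})
    (hle : u.val {x, y} + u.val {z} ≤ u.val {x, z} + u.val {y}) :
    u.IsMatroidBased := by
  obtain ⟨w, hwx, hwy, hwz⟩ : ∃ w : Fin n → ℝ, w x = 0 ∧ w y = u.val {x, y} - u.val {x} ∧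
      w z = u.val {x, z} - u.val {x} :=
    ⟨fun i => if i = x then 0 else if i = y then u.val {x, y} - u.val {x} else
      u.val {x, z} - u.val {x}, by simp, by simp [hxy.symm], by simp [hxz.symm, hyz.symm]⟩
  obtain ⟨w', hwx', hwy', hwz'⟩ : ∃ w' : Fin n → ℝ, w' x = 0 ∧ w' y = 0 ∧
      w' z = u.val {x, y, z} - u.val {x, y} :=
    ⟨fun i => if i = z then u.val {x, y, z} - u.val {x, y} else 0, by simp [hxz], by simp [hyz],
      by simp⟩
  have hx := u.val_nonneg {x}
  have hy := u.val_nonneg {y}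
  have hz := u.val_nonneg {z}
  have m1 := u.val_mono {x} {x, y} (by simp)
  have m2 := u.val_mono {y} {x, y} (by simp)
  have m3 := u.val_mono {x} {x, z} (by simp)
  have m4 := u.val_mono {z} {x, z} (by simp)
  have m5 := u.val_mono {y} {y, z} (by simp)
  have m6 := u.val_mono {z} {y, z} (by simp)
  have m7 := u.val_mono {x, y} {x, y, z} (by grind)
  have m8 := u.val_mono {x, z} {x, y, z} (by grind)
  have m9 := u.val_mono {y, z} {x, y, z} (by grind)
  have s1 := hu.val_pair_le hxy
  have s2 := hu.val_pair_le hxz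
  have s3 := hu.val_pair_le hyz
  have t1 := hu.val_triple_le hyz hxy.symm hxz.symm
  have t2 := hu.val_triple_le hxz hxy hyz.symm
  have c1 := Finset.pair_comm x y
  have c2 := Finset.pair_comm x z
  have c3 := Finset.pair_comm y z
  have d1 : ({x, z, y} : Finset (Fin n)) = {x, y, z} := by grind
  have d2 : ({y, x, z} : Finset (Fin n)) = {x, y, z} := by grind
  have d3 : ({y, z, x} : Finset (Fin n)) = {x, y, z} := by grind
  have d4 : ({z, x, y} : Finset (Fin n)) = {x, y, z} := by grind
  have d5 : ({z, y, x} : Finset (Fin n)) = {x, y, z} := by grind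
  rw [d3, ← c1, ← c2] at t1
  rw [d1, ← c3] at t2
  refine isMatroidBased_of_assignment (w₁ := fun i => u.val {i}) (w₂ := w) (w₃ := w')
    ?_ ?_ ?_ (fun i => le_rfl) ?_ ?_ ?_
  · intro i
    rcases huniv i with rfl | rfl | rfl <;> linarith
  · intro i
    rcases huniv i with rfl | rfl | rfl <;> linarith
  · intro i
    rcases huniv i with rfl | rfl | rfl
    · rw [hwx]; exact hx
    · rw [hwy]; linarith
    · rw [hwz]; linarith
  · intro i j hij
    rcases huniv i with rfl | rfl | rfl <;> rcases huniv j with rfl | rfl | rfl <;>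
      first
        | exact absurd rfl hij
        | (simp only [hwx, hwy, hwz, ← c1, ← c2, ← c3]; linarith)
  · intro i j k hij hik hjk
    rcases huniv i with rfl | rfl | rfl <;> rcases huniv j with rfl | rfl | rfl <;>
      rcases huniv k with rfl | rfl | rfl <;>
      first
        | exact absurd rfl hij
        | exact absurd rfl hik
        | exact absurd rfl hjk
        | (simp only [hwx, hwy, hwz, hwx', hwy', hwz', d1, d2, d3, d4, d5]; linarith)
  · intro S
    have hS := Finset.eq_of_subset_triple (x := x) (y := y) (z := z) (R := S)
      fun i _ => by rcases huniv i with rfl | rfl | rfl <;> simp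
    rcases hS with rfl | rfl | rfl | rfl | rfl | rfl | rfl | rfl
    · exact Or.inl rfl
    · exact Or.inr (Or.inl ⟨x, by simp, le_rfl⟩)
    · exact Or.inr (Or.inl ⟨y, by simp, le_rfl⟩)
    · exact Or.inr (Or.inl ⟨z, by simp, le_rfl⟩)
    · exact Or.inr (Or.inr (Or.inl ⟨x, by simp, y, by simp, hxy, by rw [hwy]; linarith⟩))
    · exact Or.inr (Or.inr (Or.inl ⟨x, by simp, z, by simp, hxz, by rw [hwz]; linarith⟩))
    · exact Or.inr (Or.inr (Or.inl ⟨y, by simp, z, by simp, hyz, by rw [hwz]; linarith⟩))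
    · exact Or.inr (Or.inr (Or.inr ⟨x, by simp, y, by simp, z, by simp, hxy, hxz, hyz,
        by rw [hwy, hwz']; linarith⟩))

theorem max_attained_twice {x y z : ℝ} (h1 : x ≤ max y z) (h2 : y ≤ max x z) (h3 : z ≤ max x y) :
    (x = y ∧ z ≤ y) ∨ (x = z ∧ y ≤ z) ∨ (y = z ∧ x ≤ z) := by
  rw [le_max_iff] at h1 h2 h3
  rcases h1 with h1 | h1 <;> rcases h2 with h2 | h2 <;> rcases h3 with h3 | h3 <;>
    first
      | exact Or.inl ⟨by linarith, by linarith⟩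
      | exact Or.inr (Or.inl ⟨by linarith, by linarith⟩)
      | exact Or.inr (Or.inr ⟨by linarith, by linarith⟩)

/-- The maximum of the three sums is attained twice, so a relabelling of the items gives the
equality and the inequality needed. -/
theorem IsGrossSubstitutes.isMatroidBased_of_eq_triple {u : ItemValuation n}
    (hu : u.IsGrossSubstitutes) {x y z : Fin n} (hxy : x ≠ y) (hxz : x ≠ z) (hyz : y ≠ z)
    (huniv : ∀ i, i = x ∨ i = y ∨ i = z) : u.IsMatroidBased := by
  have h1 := hu.val_pair_add_le hxy hxz hyz
  have h2 := hu.val_pair_add_le hxy.symm hyz hxz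
  have h3 := hu.val_pair_add_le hxz.symm hyz.symm hxy
  have c1 := Finset.pair_comm x y
  have c2 := Finset.pair_comm x z
  have c3 := Finset.pair_comm y z
  rw [← c1] at h2
  rw [← c2, ← c3] at h3
  rcases max_attained_twice h1 h2 h3 with ⟨e, h⟩ | ⟨e, h⟩ | ⟨e, h⟩
  · exact hu.isMatroidBased_of_val_eq hxy hxz hyz huniv e h
  · exact hu.isMatroidBased_of_val_eq hxz hxy hyz.symm (fun i => by have := huniv i; tauto)
      (by rw [← c3]; exact e) h
  · exact hu.isMatroidBased_of_val_eq hyz hxy.symm hxz.symm (fun i => by have := huniv i; tauto)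
      (by rw [← c1, ← c2]; exact e) (by rw [← c1]; exact h)

theorem IsGrossSubstitutes.isMatroidBased {u : ItemValuation n}
    (hu : u.IsGrossSubstitutes) (hn : n ≤ 3) : u.IsMatroidBased := by
  interval_cases n
  · exact isMatroidBased_of_le_one (by simp) u
  · exact isMatroidBased_of_le_one le_rfl u
  · exact hu.isMatroidBased_of_eq_pair (x := 0) (y := 1) (by decide) (by decide)
  · exact hu.isMatroidBased_of_eq_triple (x := 0) (y := 1) (z := 2) (by decide) (by decide)
      (by decide) (by decide)

end ItemValuation

/-! ### The theorem -/

theorem MBV_subset_GSV (n : ℕ) : MBV n ⊆ GSV n := fun _ hu =>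
  ItemValuation.isGrossSubstitutes_of_isExchangeable hu.isExchangeable

theorem theorem1 (n : ℕ) :
    (n ≤ 3 → MBV n = GSV n) ∧
    (4 ≤ n →
      MBV n ⊂ GSV n ∧
      ∀ (π : Finpartition (Finset.univ : Finset (Fin n))) (a b : ℝ) (ha : 0 < a) (hab : a < b),
        b < 2 * a → 2 ≤ π.parts.card → (∀ P ∈ π.parts, 2 ≤ P.card) →
        ItemValuation.partitionValuation π a b ha hab ∈ GSV n \ MBV n) := by
  refine ⟨fun hn => (MBV_subset_GSV n).antisymm fun u hu =>
    ItemValuation.IsGrossSubstitutes.isMatroidBased hu hn, fun hn => ?_⟩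
  have key : ∀ (π : Finpartition (Finset.univ : Finset (Fin n))) (a b : ℝ) (ha : 0 < a)
      (hab : a < b), b < 2 * a → 2 ≤ π.parts.card → (∀ P ∈ π.parts, 2 ≤ P.card) →
      ItemValuation.partitionValuation π a b ha hab ∈ GSV n \ MBV n :=
    fun π a b ha hab hb hπ hcard => ⟨ItemValuation.isGrossSubstitutes_of_isExchangeable
      (ItemValuation.partitionValuation_isExchangeable π a b ha hab hb),
      ItemValuation.not_isMatroidBased_partitionValuation hb hπ hcard⟩
  refine ⟨⟨MBV_subset_GSV n, fun h => ?_⟩, key⟩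
  obtain ⟨π, hπ, hcard⟩ := ItemValuation.exists_finpartition_two_le hn
  have := key π 2 3 (by norm_num) (by norm_num) (by norm_num) hπ hcard
  exact this.2 (h this.1)
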